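/- Let $\mathbb D=\{z\in\mathbb C:|z|<1\}$. Let $S_H$ be the class of univalent, sense-preserving harmonic functions $f=h+\overline g$ in $\mathbb D$, where $h,g$ are analytic in $\mathbb D$ with $h(0)=g(0)=0$ and $h'(0)=1$. For analytic $h(z)=\sum_k a_kz^k$ and $H(z)=\sum_k A_kz^k$ in $\mathbb D$ put $(h*H)(z)=\sum_k a_kA_kz^k$, and for harmonic mappings put $(h+\overline g)\,\tilde *\,(H+\overline G)=h*H+\overline{g*G}$. A set $E\subset\mathbb C$ is convex in the direction $\psi\in\mathbb R$ if every line parallel to the line through $0$ and $e^{i\psi}$ has an empty or connected intersection with $E$; a function on $\mathbb D$ is convex in the direction $\psi$ if its image of $\mathbb D$ is. **Theorem.** Let $n\ge 1$ be an integer, let $\alpha,\eta,\gamma,\theta\in\mathbb R$, and let $a\in\left[\frac{n-2}{n+2},1\right)$. Let $F_{(a,\alpha)}=H+\overline G$, with $H,G$ analytic in $\mathbb D$ and $H(0)=G(0)=0$, be the slanted right half-plane mapping given by $$H(z)+e^{-2i\alpha}G(z)=\frac{z}{1-ze^{i\alpha}},\qquad \frac{G'(z)}{H'(z)}=e^{2i\alpha}\,\frac{a-ze^{i\alpha}}{1-aze^{i\alpha}}\qquad(z\in\mathbb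 D).$$ Let $T_{(\eta,\gamma)}=R+\overline S$, with $R,S$ analytic in $\mathbb D$ and $R(0)=S(0)=0$, be given by $$R(z)+e^{-2i\gamma}S(z)=f(z),\qquad \frac{S'(z)}{R'(z)}=e^{i\theta}z^n\qquad(z\in\mathbb D),$$ where $f$ is analytic in $\mathbb D$ with $$zf'(z)=\frac{z}{(1+ze^{i(\eta+\gamma)})(1+ze^{-i(\eta-\gamma)})}.$$ Then $F_{(a,\alpha)}\,\tilde *\,T_{(\eta,\gamma)}$ is univalent, sense-preserving and harmonic in $\mathbb D$ and belongs to $S_H$ after normalization, that is, $(1+a)\left(F_{(a,\alpha)}\,\tilde *\,T_{(\eta,\gamma)}\right)\in S_H$. Moreover, $F_{(a,\alpha)}\,\tilde *\,T_{(\eta,\gamma)}$ is convex in the direction $-(\alpha+\gamma)$. -/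

import Mathlib

open scoped ComplexConjugate

noncomputable section

/-- The open unit disc of the complex plane. -/
def unitDisc : Set ℂ := Metric.ball (0 : ℂ) 1

/-- The `k`-th Taylor coefficient at the origin of an analytic function. -/
def taylorCoeff (h : ℂ → ℂ) (k : ℕ) : ℂ := iteratedDeriv k h 0 / (k.factorial : ℂ)

/-- The Hadamard product of two analytic functions:
if `h = ∑ aₖ zᵏ` and `H = ∑ Aₖ zᵏ`, then `h * H = ∑ aₖ Aₖ zᵏ`. -/
def hadamard (h H : ℂ → ℂ) (z : ℂ) : ℂ :=
  ∑' k : ℕ, taylorCoeff h k * taylorCoeff H k * z ^ k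

/-- The convolution of the harmonic mappings `h + conj g` and `H + conj G`, namely
`h * H + conj (g * G)`. -/
def harmonicConv (h g H G : ℂ → ℂ) (z : ℂ) : ℂ :=
  hadamard h H z + conj (hadamard g G z)

/-- The class `S_H`: univalent, sense-preserving harmonic functions `f = h + conj g` in the unit
disc, with `h` and `g` analytic and `h(0) = g(0) = 0`, `h'(0) = 1`. -/
def classSH : Set (ℂ → ℂ) :=
  {f | InnerProductSpace.HarmonicOnNhd f unitDisc ∧ Set.InjOn f unitDisc ∧
    ∃ h g : ℂ → ℂ, DifferentiableOn ℂ h unitDisc ∧ DifferentiableOn ℂ g unitDisc ∧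
      (∀ z ∈ unitDisc, f z = h z + conj (g z)) ∧
      h 0 = 0 ∧ g 0 = 0 ∧ deriv h 0 = 1 ∧
      ∀ z ∈ unitDisc, ‖deriv g z‖ < ‖deriv h z‖}

/-- A set `E` is convex in the direction `ψ` if every line parallel to the line through `0` and
`e^{iψ}` has an empty or connected intersection with `E`. -/
def ConvexInDirection (ψ : ℝ) (E : Set ℂ) : Prop :=
  ∀ w : ℂ, IsPreconnected
    (E ∩ Set.range fun t : ℝ => w + (t : ℂ) * Complex.exp (Complex.I * (ψ : ℂ)))

/-- `H` and `G` are the analytic and co-analytic parts of the mapping `F_{(a,α)} = H + conj G`. The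
dilatation equation `G'/H' = ω` is written `G' = ω H'`; the derivative of `sum_eq` then forces
`H' ≠ 0` in the disc. -/
structure IsSlantedHalfPlaneMap (a α : ℝ) (H G : ℂ → ℂ) : Prop where
  analytic_H : DifferentiableOn ℂ H unitDisc
  analytic_G : DifferentiableOn ℂ G unitDisc
  H_zero : H 0 = 0
  G_zero : G 0 = 0
  sum_eq : ∀ z ∈ unitDisc,
    H z + Complex.exp (-2 * Complex.I * α) * G z = z / (1 - z * Complex.exp (Complex.I * α))
  dilatation : ∀ z ∈ unitDisc,
    deriv G z = Complex.exp (2 * Complex.I * α) *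
      ((a - z * Complex.exp (Complex.I * α)) / (1 - a * z * Complex.exp (Complex.I * α))) *
        deriv H z

/-- `R` and `S` are the analytic and co-analytic parts of the mapping
`T_{(η,γ)} = R + conj S` with dilatation `e^{iθ} zⁿ`. -/
structure IsTMap (η γ θ : ℝ) (n : ℕ) (R S : ℂ → ℂ) : Prop where
  analytic_R : DifferentiableOn ℂ R unitDisc
  analytic_S : DifferentiableOn ℂ S unitDisc
  R_zero : R 0 = 0
  S_zero : S 0 = 0
  sum_eq : ∃ f : ℂ → ℂ, DifferentiableOn ℂ f unitDisc ∧
    (∀ z ∈ unitDisc, z * deriv f z =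
      z / ((1 + z * Complex.exp (Complex.I * (η + γ))) *
        (1 + z * Complex.exp (-Complex.I * (η - γ))))) ∧
    ∀ z ∈ unitDisc, R z + Complex.exp (-2 * Complex.I * γ) * S z = f z
  dilatation : ∀ z ∈ unitDisc,
    deriv S z = Complex.exp (Complex.I * θ) * z ^ n * deriv R z

end

/-! Put `u = e^{iα}`, `c = (1-a)/(1+a)`. Integrating the dilatation equation gives `H - e^{-2iα}G =
c z/(1-uz)²`, so the coefficients of `H` and `G` are geometric in `u` times `1 ± ck`. Convolving
with `F` therefore acts on `R` and `S` as `id ± c z d/dz`, up to rotations and constants. Rotating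
the variable as well reduces the problem to `P + conj Q`, where `P = R + c v R'`, `Q = S - c v S'`,
`R' + S' = 1/d` with `d = 1 + 2v cos η + v²`, and `S' = ω R'` with `ω = ζ vⁿ`, `|ζ| = 1`.

Let `Y = (1-v²)/d` and `Z = (1-ω)/(1+ω)`, both of positive real part in the disc, and `B = c(Y +
(n/2)Z)`. Logarithmic differentiation of `R'` gives `P' = R'(1 - cn/2 + B)` and `Q' = ω R'(1 - cn/2
- B)`. The bound on `a` says exactly that `1 - cn/2 ≥ 0`, hence `|Q'| < |P'|` (`norm_deriv_lt`).
Moreover `d (P' - Q') = Z + cY` has positive real part.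

The last fact makes a shear argument work. A solution of `V' = k d(V)`, `k > 0`, maps a vertical
strip or half-plane onto the disc (`exists_strip_param`), and `f = (P - Q) ∘ V` has `Re f' > 0`
there. Thus `Im f` increases along vertical lines and its level sets are graphs; a maximum principle
argument shows that they lie over intervals (`exists_lt_im`), so they are connected. Since `P + conj
Q` has imaginary part `Im (P - Q)`, its horizontal slices are images of these level sets. Along each
of them its real part `Re (P + Q)` increases with `Re f`, because `(P' + Q')/(P' - Q')` has positive
real part; this gives univalence. -/

/-! ### Taylor coefficients and Hadamard products in the disc -/

theorem isOpen_unitDisc : IsOpen unitDisc := Metric.isOpen_ball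

theorem mem_unitDisc_iff {z : ℂ} : z ∈ unitDisc ↔ ‖z‖ < 1 := by
  simp [unitDisc]

theorem zero_mem_unitDisc : (0 : ℂ) ∈ unitDisc := by simp [mem_unitDisc_iff]

theorem HasSum.of_eq {f g : ℕ → ℂ} {x y : ℂ} (h : HasSum g x) (hf : ∀ k, f k = g k) (hx : x = y) :
    HasSum f y := by
  rw [funext hf, ← hx]
  exact h

theorem DifferentiableOn.differentiableAt_unitDisc {h : ℂ → ℂ} (hh : DifferentiableOn ℂ h unitDisc)
    {z : ℂ} (hz : z ∈ unitDisc) : DifferentiableAt ℂ h z :=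
  hh.differentiableAt (isOpen_unitDisc.mem_nhds hz)

theorem differentiableOn_deriv_unitDisc {h : ℂ → ℂ} (hh : DifferentiableOn ℂ h unitDisc) :
    DifferentiableOn ℂ (deriv h) unitDisc := by
  have := DifferentiableOn.analyticOnNhd hh isOpen_unitDisc
  exact this.deriv.differentiableOn

theorem hasSum_taylorCoeff {h : ℂ → ℂ} (hh : DifferentiableOn ℂ h unitDisc) {z : ℂ}
    (hz : z ∈ unitDisc) : HasSum (fun k => taylorCoeff h k * z ^ k) (h z) := by
  refine (Complex.hasSum_taylorSeries_on_ball hh hz).of_eq (fun k => ?_) rfl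
  simp only [taylorCoeff, sub_zero, smul_eq_mul]
  ring

theorem hasSum_natCast_mul_taylorCoeff {h : ℂ → ℂ} (hh : DifferentiableOn ℂ h unitDisc) {z : ℂ}
    (hz : z ∈ unitDisc) : HasSum (fun k : ℕ => k * taylorCoeff h k * z ^ k) (z * deriv h z) := by
  have := (hasSum_taylorCoeff (differentiableOn_deriv_unitDisc hh) hz).mul_left z
  rw [← hasSum_nat_add_iff' 1]
  simp only [Finset.range_one, Finset.sum_singleton, Nat.cast_zero, zero_mul, sub_zero]
  refine this.of_eq (fun k => ?_) rfl
  have h1 : ((k : ℂ) + 1) ≠ 0 := by exact_mod_cast k.succ_ne_zero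
  have h2 : ((k.factorial : ℕ) : ℂ) ≠ 0 := by exact_mod_cast k.factorial_ne_zero
  simp only [taylorCoeff, iteratedDeriv_succ', Nat.factorial_succ, Nat.cast_mul, Nat.cast_add,
    Nat.cast_one]
  field_simp
  ring

theorem taylorCoeff_eq_of_hasSum {h : ℂ → ℂ} {b : ℕ → ℂ}
    (hs : ∀ z ∈ unitDisc, HasSum (fun k => b k * z ^ k) (h z)) (k : ℕ) : taylorCoeff h k = b k := by
  have h1 : HasFPowerSeriesAt h (FormalMultilinearSeries.ofScalars ℂ b) 0 := by
    rw [hasFPowerSeriesAt_iff]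
    filter_upwards [isOpen_unitDisc.mem_nhds zero_mem_unitDisc] with z hz
    simpa [mul_comm] using hs z hz
  have h2 := h1.analyticAt.hasFPowerSeriesAt
  have h3 := congrArg (fun p => p.coeff k) (h2.eq_formalMultilinearSeries h1)
  simpa [taylorCoeff] using h3

/-- Convolving with a function whose coefficients are `c₀ u ^ k (1 + c k)` is `c₀` times a rotation of `id + c z d/dz`. -/
theorem hadamard_eq_of_taylorCoeff {h R : ℂ → ℂ} {c₀ c u : ℂ} (hu : ‖u‖ = 1)
    (hR : DifferentiableOn ℂ R unitDisc) (hR0 : R 0 = 0)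
    (hh : ∀ k : ℕ, k ≠ 0 → taylorCoeff h k = c₀ * u ^ k * (1 + c * k)) {z : ℂ}
    (hz : z ∈ unitDisc) :
    hadamard h R z = c₀ * (R (u * z) + c * (u * z * deriv R (u * z))) := by
  have huz : u * z ∈ unitDisc := by
    rw [mem_unitDisc_iff] at *
    simpa [hu] using hz
  have h1 := ((hasSum_taylorCoeff hR huz).add
    ((hasSum_natCast_mul_taylorCoeff hR huz).mul_left c)).mul_left c₀
  unfold hadamard
  rw [← h1.tsum_eq]
  refine tsum_congr fun k => ?_
  -- The coefficient formula is not assumed at `k = 0`; that term vanishes because `R 0 = 0`.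
  rcases eq_or_ne k 0 with rfl | hk
  · simp [taylorCoeff, hR0]
  · rw [hh k hk]
    ring

/-! ### Coefficients of the slanted half-plane mapping -/

section Coefficients

variable {a α : ℝ} {H G : ℂ → ℂ}

theorem one_sub_mul_ne_zero {b u z : ℂ} (hb : ‖b‖ ≤ 1) (hu : ‖u‖ = 1) (hz : z ∈ unitDisc) :
    1 - b * (z * u) ≠ 0 := by
  intro h
  have h1 : b * (z * u) = 1 := by linear_combination -h
  have h2 : ‖b‖ * ‖z‖ = 1 := by simpa [hu] using congrArg norm h1
  rw [mem_unitDisc_iff] at hz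
  nlinarith [norm_nonneg b, norm_nonneg z]

theorem norm_exp_I_mul (x : ℝ) : ‖Complex.exp (Complex.I * x)‖ = 1 := by
  rw [mul_comm]; exact Complex.norm_exp_ofReal_mul_I x

/-- Both sides vanish at `0`. The two equations for `H'` and `G'` form a linear system whose
solution shows that the derivatives agree. -/
theorem IsSlantedHalfPlaneMap.sub_eq (hF : IsSlantedHalfPlaneMap a α H G) (ha : -1 < a)
    (ha1 : a < 1) {z : ℂ} (hz : z ∈ unitDisc) :
    H z - Complex.exp (-2 * Complex.I * α) * G z =
      (1 - a) / (1 + a) * (z / (1 - z * Complex.exp (Complex.I * α)) ^ 2) := by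
  set u := Complex.exp (Complex.I * α) with hu
  have hun : ‖u‖ = 1 := norm_exp_I_mul α
  set e := Complex.exp (-2 * Complex.I * α) with he
  have hee : e * Complex.exp (2 * Complex.I * α) = 1 := by
    rw [he, ← Complex.exp_add, ← Complex.exp_zero]; congr 1; ring
  have ha0 : (1 + a : ℂ) ≠ 0 := by
    norm_cast; linarith
  have hden : ∀ z ∈ unitDisc, 1 - z * u ≠ 0 := fun z hz => by
    simpa using one_sub_mul_ne_zero (b := 1) (by simp) hun hz
  have hden2 : ∀ z ∈ unitDisc, 1 - a * z * u ≠ 0 := fun z hz => by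
    have := one_sub_mul_ne_zero (b := (a : ℂ))
      (by rw [Complex.norm_real, Real.norm_eq_abs, abs_le]; constructor <;> linarith) hun hz
    rwa [← mul_assoc] at this
  have key : ∀ z ∈ unitDisc, HasDerivAt (fun z => H z - e * G z -
      (1 - a) / (1 + a) * (z / (1 - z * u) ^ 2)) 0 z := by
    intro z hz
    have hH := (hF.analytic_H.differentiableAt_unitDisc hz).hasDerivAt
    have hG := (hF.analytic_G.differentiableAt_unitDisc hz).hasDerivAt
    have hl : HasDerivAt (fun z => 1 - z * u) (-u) z := by
      simpa using ((hasDerivAt_id z).mul_const u).const_sub 1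
    have h1 := (hasDerivAt_id z).div hl (hden z hz)
    have h2 : HasDerivAt (fun z => H z + e * G z) (deriv H z + e * deriv G z) z :=
      hH.add (hG.const_mul e)
    have h3 := h2.unique (h1.congr_of_eventuallyEq (by
      filter_upwards [isOpen_unitDisc.mem_nhds hz] with w hw using hF.sum_eq w hw))
    have h4 := hF.dilatation z hz
    refine HasDerivAt.congr_deriv ((hH.sub (hG.const_mul e)).sub
      (((hasDerivAt_id z).div (hl.pow 2) (pow_ne_zero 2 (hden z hz))).const_mul
        ((1 - a : ℂ) / (1 + a)))) ?_
    have d1 := hden z hz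
    have d2 := hden2 z hz
    have h5 : e * deriv G z = (a - z * u) / (1 - a * z * u) * deriv H z := by
      rw [h4]; linear_combination ((a - z * u) / (1 - a * z * u) * deriv H z) * hee
    simp only [id, Nat.cast_ofNat, Pi.pow_apply] at h3 ⊢
    rw [h5] at h3 ⊢
    -- Eliminating `G'` leaves `H'` times `1 + (a - zu)/(1 - azu) = (1+a)(1-zu)/(1-azu)`.
    have h6 : deriv H z = (1 - a * z * u) / ((1 + a) * (1 - z * u) ^ 3) := by
      have h7 : deriv H z * ((1 + a) * (1 - z * u)) / (1 - a * z * u) = 1 / (1 - z * u) ^ 2 := by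
        rw [show (1 : ℂ) / (1 - z * u) ^ 2 = (1 * (1 - z * u) - z * -u) / (1 - z * u) ^ 2 by ring,
          ← h3]
        field_simp
        ring
      field_simp at h7 ⊢
      linear_combination h7
    rw [h6]
    field_simp
    ring
  have hconst := isOpen_unitDisc.is_const_of_deriv_eq_zero
    (convex_ball (0 : ℂ) 1).isPreconnected
    (fun z hz => (key z hz).differentiableAt.differentiableWithinAt)
    (fun z hz => (key z hz).deriv) hz zero_mem_unitDisc
  simp only [hF.H_zero, hF.G_zero, mul_zero, sub_zero, zero_div] at hconst
  exact sub_eq_zero.mp hconst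

/-- Half the sum and half the difference of the series of `z/(1-uz)` and `c z/(1-uz)²`. -/
theorem IsSlantedHalfPlaneMap.taylorCoeff_eq (hF : IsSlantedHalfPlaneMap a α H G) (ha : -1 < a)
    (ha1 : a < 1) (k : ℕ) (hk : k ≠ 0) :
    taylorCoeff H k = Complex.exp (-(Complex.I * α)) / 2 * Complex.exp (Complex.I * α) ^ k *
        (1 + (1 - a) / (1 + a) * k) ∧
      taylorCoeff G k = Complex.exp (Complex.I * α) / 2 * Complex.exp (Complex.I * α) ^ k *
        (1 + -((1 - a) / (1 + a)) * k) := by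
  set u := Complex.exp (Complex.I * α) with hu
  have hun : ‖u‖ = 1 := norm_exp_I_mul α
  have hu0 : u ≠ 0 := Complex.exp_ne_zero _
  have he : Complex.exp (-2 * Complex.I * α) = (u ^ 2)⁻¹ := by
    rw [hu, ← Complex.exp_nat_mul, ← Complex.exp_neg]; congr 1; push_cast; ring
  rw [Complex.exp_neg]
  set c : ℂ := (1 - a) / (1 + a)
  have hden : ∀ z ∈ unitDisc, 1 - z * u ≠ 0 := fun z hz => by
    simpa using one_sub_mul_ne_zero (b := 1) (by simp) hun hz
  have s1 : ∀ z ∈ unitDisc,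
      HasSum (fun k : ℕ => (if k = 0 then 0 else u⁻¹ * u ^ k) * z ^ k) (z / (1 - z * u)) := by
    intro z hz
    have hzu : ‖z * u‖ < 1 := by rw [norm_mul, hun, mul_one]; exact mem_unitDisc_iff.1 hz
    rw [← hasSum_nat_add_iff' 1]
    refine ((hasSum_geometric_of_norm_lt_one hzu).mul_left z).of_eq (fun k => ?_) ?_
    · simp only [Nat.add_eq_zero_iff, one_ne_zero, and_false, if_false]
      field_simp
      ring
    · simp [div_eq_mul_inv]
  have s2 : ∀ z ∈ unitDisc,
      HasSum (fun k : ℕ => (u⁻¹ * k * u ^ k) * z ^ k) (z / (1 - z * u) ^ 2) := by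
    intro z hz
    have hzu : ‖z * u‖ < 1 := by rw [norm_mul, hun, mul_one]; exact mem_unitDisc_iff.1 hz
    refine ((hasSum_coe_mul_geometric_of_norm_lt_one hzu).mul_left u⁻¹).of_eq (fun k => ?_) ?_
    · ring
    · field_simp
  have e1 := fun z hz => hF.sum_eq z hz
  have e2 := fun z hz => hF.sub_eq ha ha1 (z := z) hz
  simp only [he] at e1 e2
  have tH := taylorCoeff_eq_of_hasSum (h := H)
    (b := fun k => ((if k = 0 then 0 else u⁻¹ * u ^ k) + c * (u⁻¹ * k * u ^ k)) / 2)
    (fun z hz => by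
      refine (((s1 z hz).add ((s2 z hz).mul_left c)).div_const 2).of_eq (fun k => ?_) ?_
      · ring
      · rw [← e2 z hz, ← e1 z hz]; ring) k
  have tG := taylorCoeff_eq_of_hasSum (h := G)
    (b := fun k => u ^ 2 * ((if k = 0 then 0 else u⁻¹ * u ^ k) - c * (u⁻¹ * k * u ^ k)) / 2)
    (fun z hz => by
      refine ((((s1 z hz).sub ((s2 z hz).mul_left c)).mul_left (u ^ 2)).div_const 2).of_eq
        (fun k => ?_) ?_
      · ring
      · rw [← e2 z hz, ← e1 z hz]; field_simp; ring) k
  simp only [hk, if_false] at tH tG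
  rw [tH, tG]
  constructor
  · ring
  · field_simp
    ring

end Coefficients

/-! ### Level sets of the imaginary part on a vertical strip -/

open Complex Set Filter Topology

theorem re_cos_add_mul_I (x y : ℝ) :
    (Complex.cos (x + y * Complex.I)).re = Real.cos x * Real.cosh y := by
  rw [Complex.cos_add_mul_I, ← Complex.ofReal_cos, ← Complex.ofReal_cosh, ← Complex.ofReal_sin,
    ← Complex.ofReal_sinh, Complex.sub_re, ← Complex.ofReal_mul, ← Complex.ofReal_mul,
    Complex.ofReal_re, Complex.re_ofReal_mul, Complex.I_re, mul_zero, sub_zero]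

/-- `f` is holomorphic with derivative of positive real part on the vertical strip
`{w | w.re ∈ I}` over the open interval `I`. -/
structure IsStripMap (I : Set ℝ) (f : ℂ → ℂ) : Prop where
  isOpen : IsOpen I
  ordConnected : I.OrdConnected
  differentiableAt : ∀ w : ℂ, w.re ∈ I → DifferentiableAt ℂ f w
  re_deriv_pos : ∀ w : ℂ, w.re ∈ I → 0 < (deriv f w).re

namespace IsStripMap

variable {I : Set ℝ} {f : ℂ → ℂ}

/-- This symmetry turns statements about large `Im f` into statements about small `Im f`. -/
theorem neg (hf : IsStripMap I f) : IsStripMap (-I) (fun w => -f (-w)) where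
  isOpen := hf.isOpen.neg
  ordConnected :=
    ⟨fun _ hx _ hy _ hz => hf.ordConnected.out hy hx ⟨neg_le_neg hz.2, neg_le_neg hz.1⟩⟩
  differentiableAt w hw :=
    ((hf.differentiableAt (-w) (by simpa using hw)).comp w differentiable_neg.differentiableAt).neg
  re_deriv_pos w hw := by
    have h := hf.re_deriv_pos (-w) (by simpa using hw)
    have hd : HasDerivAt (fun w => -f (-w)) (-(deriv f (-w) * -1)) w :=
      ((hf.differentiableAt (-w) (by simpa using hw)).hasDerivAt.comp w (hasDerivAt_neg w)).neg
    rw [hd.deriv]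
    simpa using h

theorem strictMono_im (hf : IsStripMap I f) {x : ℝ} (hx : x ∈ I) :
    StrictMono fun t : ℝ => (f (x + t * Complex.I)).im := by
  apply strictMono_of_deriv_pos
  intro t
  have hw : ((x : ℂ) + t * Complex.I).re ∈ I := by simpa using hx
  have h1 : HasDerivAt (fun t : ℝ => (x : ℂ) + t * Complex.I) Complex.I t := by
    simpa using ((hasDerivAt_id t).ofReal_comp.mul_const Complex.I).const_add (x : ℂ)
  have h2 := (hf.differentiableAt _ hw).hasDerivAt.comp t h1
  have h3 : HasDerivAt (fun t : ℝ => (f (x + t * Complex.I)).im)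
      (deriv f (x + t * Complex.I) * Complex.I).im t :=
    (Complex.imCLM.hasFDerivAt.comp_hasDerivAt t h2)
  rw [h3.deriv]
  simpa using hf.re_deriv_pos _ hw

/-- If `Im f ≤ s` on the whole middle line, compare with the outer lines, where `Im f` stays above
some `σ > s` from a certain height on. The maximum principle for `exp (i f)` on a tall rectangle,
damped by a cosine factor in the Phragmén–Lindelöf manner, forces `Im f > s` at mid-height. -/
theorem exists_lt_im (hf : IsStripMap I f) {s x₁ x₀ x₂ t₁ t₂ : ℝ} (hx₁ : x₁ ∈ I) (hx₂ : x₂ ∈ I)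
    (h₁₀ : x₁ < x₀) (h₀₂ : x₀ < x₂) (h₁ : s < (f (x₁ + t₁ * Complex.I)).im)
    (h₂ : s < (f (x₂ + t₂ * Complex.I)).im) : ∃ t : ℝ, s < (f (x₀ + t * Complex.I)).im := by
  by_contra! hcon
  have hI : Icc x₁ x₂ ⊆ I := hf.ordConnected.out hx₁ hx₂
  have h₁₂ : x₁ < x₂ := h₁₀.trans h₀₂
  obtain ⟨σ, hsσ, hσ₁, hσ₂⟩ : ∃ σ, s < σ ∧ σ ≤ (f (x₁ + t₁ * Complex.I)).im ∧
      σ ≤ (f (x₂ + t₂ * Complex.I)).im :=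
    ⟨min _ _, lt_min h₁ h₂, min_le_left _ _, min_le_right _ _⟩
  set T := max t₁ t₂
  have hcont : ContinuousOn (fun x : ℝ => (f (x + T * Complex.I)).im) (Icc x₁ x₂) := by
    intro x hx
    have := (hf.differentiableAt (x + T * Complex.I) (by simpa using hI hx)).continuousAt
    exact (Complex.continuous_im.continuousAt.comp (ContinuousAt.comp (f := fun x : ℝ =>
      (x + T * Complex.I : ℂ)) this (by fun_prop))).continuousWithinAt
  obtain ⟨m, hm⟩ := (isCompact_Icc.image_of_continuousOn hcont).bddBelow
  -- Monotonicity in `t` carries the minimum on the bottom edge to a lower bound on the whole upper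
  -- half-strip.
  have hm' : ∀ x ∈ Icc x₁ x₂, ∀ t, T ≤ t → m ≤ (f (x + t * Complex.I)).im := fun x hx t ht =>
    (hm ⟨x, hx, rfl⟩).trans ((hf.strictMono_im (hI hx)).monotone ht)
  -- With this `k` the argument `k (x - xc)` stays in `[-1/2, 1/2]`, where cosine is at least `1/2`.
  set k := (x₂ - x₁)⁻¹ with hk
  have hk0 : 0 < k := inv_pos.2 (sub_pos.2 h₁₂)
  set C := (σ - s) / 2 with hC
  have hC0 : 0 < C := by rw [hC]; linarith
  -- The half-height `L` is so large that damping on the horizontal edges makes up for the poor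
  -- bound `m`.
  obtain ⟨L, hL0, hL⟩ : ∃ L : ℝ, 0 < L ∧ σ - m ≤ C * (1 / 2) * Real.cosh (k * L) := by
    have : Tendsto (fun L : ℝ => C * (1 / 2) * Real.cosh (k * L)) atTop atTop := by
      refine Tendsto.const_mul_atTop (by positivity) ?_
      refine tendsto_atTop_mono' _ ?_ (Tendsto.const_mul_atTop hk0 tendsto_id)
      filter_upwards [eventually_ge_atTop 0] with L hL
      exact (Real.self_le_sinh_iff.2 (mul_nonneg hk0.le hL)).trans (Real.sinh_lt_cosh _).le
    obtain ⟨L, h1, h2⟩ := ((eventually_gt_atTop 0).and (this.eventually_ge_atTop (σ - m))).exists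
    exact ⟨L, h1, h2⟩
  set xc := (x₁ + x₂) / 2 with hxc
  set tc := T + L with htc
  set g : ℂ → ℂ := fun w => Complex.exp (Complex.I * f w -
    C * Complex.cos (k * (w - (xc + tc * Complex.I)))) with hg
  have hnorm : ∀ x t : ℝ, ‖g (x + t * Complex.I)‖ =
      Real.exp (-(f (x + t * Complex.I)).im -
        C * (Real.cos (k * (x - xc)) * Real.cosh (k * (t - tc)))) := by
    intro x t
    rw [hg, Complex.norm_exp]
    congr 1
    have : (k : ℂ) * (x + t * Complex.I - (xc + tc * Complex.I)) =
        ((k * (x - xc) : ℝ) : ℂ) + ((k * (t - tc) : ℝ) : ℂ) * Complex.I := by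
      push_cast; ring
    rw [this, Complex.sub_re, Complex.I_mul_re, Complex.re_ofReal_mul, re_cos_add_mul_I]
  have hcos : ∀ x ∈ Icc x₁ x₂, 1 / 2 ≤ Real.cos (k * (x - xc)) := by
    intro x hx
    have h1 : |k * (x - xc)| ≤ 1 / 2 := by
      rw [abs_mul, abs_of_pos hk0, hk, inv_mul_le_iff₀ (sub_pos.2 h₁₂), abs_le]
      constructor <;> rw [hxc] <;> linarith [hx.1, hx.2]
    have h2 := Real.one_sub_sq_div_two_le_cos (x := k * (x - xc))
    have h3 := sq_abs (k * (x - xc))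
    nlinarith [abs_nonneg (k * (x - xc))]
  have hle : ∀ w ∈ closure (Ioo x₁ x₂ ×ℂ Ioo T (T + 2 * L)), ‖g w‖ ≤ Real.exp (-σ) := by
    have hcl : closure (Ioo x₁ x₂ ×ℂ Ioo T (T + 2 * L)) = Icc x₁ x₂ ×ℂ Icc T (T + 2 * L) := by
      rw [Complex.closure_reProdIm, closure_Ioo h₁₂.ne, closure_Ioo (by linarith)]
    intro w hw
    refine Complex.norm_le_of_forall_mem_frontier_norm_le
      ((Metric.isBounded_Ioo _ _).reProdIm (Metric.isBounded_Ioo _ _)) ?_ ?_ hw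
    · apply DifferentiableOn.diffContOnCl
      rw [hcl]
      intro w hw
      have := hf.differentiableAt w (hI hw.1)
      refine DifferentiableAt.differentiableWithinAt ?_
      rw [hg]
      fun_prop
    · intro w hw
      rw [Complex.frontier_reProdIm, closure_Ioo h₁₂.ne, closure_Ioo (by linarith),
        frontier_Ioo h₁₂, frontier_Ioo (by linarith)] at hw
      rw [← Complex.re_add_im w, hnorm]
      apply Real.exp_le_exp.2
      rcases hw with ⟨hx, ht⟩ | ⟨hx, ht⟩
      · have ht : w.im = T ∨ w.im = T + 2 * L := ht
        have h1 := hm' w.re hx w.im (by rcases ht with h | h <;> linarith)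
        have h2 : Real.cosh (k * (w.im - tc)) = Real.cosh (k * L) := by
          rcases ht with h | h
          · rw [h, ← Real.cosh_neg]; congr 1; rw [htc]; ring
          · rw [h]; congr 1; rw [htc]; ring
        rw [h2]
        have h3 := hcos w.re hx
        have h4 := Real.cosh_pos (k * L)
        have h5 : 1 / 2 * Real.cosh (k * L) ≤ Real.cos (k * (w.re - xc)) * Real.cosh (k * L) := by
          gcongr
        nlinarith
      · have hx : w.re = x₁ ∨ w.re = x₂ := hx
        have h0 : 0 ≤ C * (Real.cos (k * (w.re - xc)) * Real.cosh (k * (w.im - tc))) := by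
          have h3 := hcos w.re (by
            rcases hx with h | h <;> rw [h] <;> constructor <;> linarith)
          have h4 := Real.cosh_pos (k * (w.im - tc))
          have : 0 ≤ Real.cos (k * (w.re - xc)) := by linarith
          positivity
        have h1 : σ ≤ (f (w.re + w.im * Complex.I)).im := by
          rcases hx with h | h
          · rw [h]
            exact hσ₁.trans ((hf.strictMono_im hx₁).monotone ((le_max_left _ _).trans ht.1))
          · rw [h]
            exact hσ₂.trans ((hf.strictMono_im hx₂).monotone ((le_max_right _ _).trans ht.1))
        linarith
  have hfin := hle (x₀ + tc * Complex.I) (subset_closure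
    ⟨by simpa using ⟨h₁₀, h₀₂⟩, by
      have : tc ∈ Ioo T (T + 2 * L) := by constructor <;> rw [htc] <;> linarith
      simpa using this⟩)
  -- At mid-height the `cosh` is `1`, so `Im f ≥ σ - C = (σ + s)/2 > s`.
  rw [hnorm, Real.exp_le_exp] at hfin
  simp only [sub_self, mul_zero, Real.cosh_zero, mul_one] at hfin
  have h6 := hcon tc
  have h7 := Real.cos_le_one (k * (x₀ - xc))
  nlinarith

/-- The abscissae over which a level set of the imaginary part lives form an interval. -/
theorem ordConnected_level (hf : IsStripMap I f) (s : ℝ) :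
    {x | x ∈ I ∧ ∃ t : ℝ, (f (x + t * Complex.I)).im = s}.OrdConnected := by
  refine ⟨?_⟩
  rintro x₁ ⟨hx₁, t₁, h₁⟩ x₂ ⟨hx₂, t₂, h₂⟩ x₀ ⟨h₁₀, h₀₂⟩
  have hx₀ : x₀ ∈ I := hf.ordConnected.out hx₁ hx₂ ⟨h₁₀, h₀₂⟩
  refine ⟨hx₀, ?_⟩
  rcases h₁₀.eq_or_lt with rfl | h₁₀
  · exact ⟨t₁, h₁⟩
  rcases h₀₂.eq_or_lt with rfl | h₀₂
  · exact ⟨t₂, h₂⟩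
  have hup : ∃ t : ℝ, s < (f (x₀ + t * Complex.I)).im := by
    refine hf.exists_lt_im (t₁ := t₁ + 1) (t₂ := t₂ + 1) hx₁ hx₂ h₁₀ h₀₂ ?_ ?_
    · rw [← h₁]; exact hf.strictMono_im hx₁ (by linarith)
    · rw [← h₂]; exact hf.strictMono_im hx₂ (by linarith)
  have hdown : ∃ t : ℝ, (f (x₀ + t * Complex.I)).im < s := by
    have e : ∀ x t : ℝ, -(((-x : ℝ) : ℂ) + ((-t : ℝ) : ℂ) * Complex.I) = x + t * Complex.I := by
      intro x t; push_cast; ring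
    obtain ⟨t, ht⟩ := hf.neg.exists_lt_im (s := -s) (x₁ := -x₂) (x₀ := -x₀) (x₂ := -x₁)
      (t₁ := -(t₂ - 1)) (t₂ := -(t₁ - 1)) (by simpa using hx₂) (by simpa using hx₁)
      (by linarith) (by linarith)
      (by
        rw [e, Complex.neg_im, neg_lt_neg_iff, ← h₂]
        exact hf.strictMono_im hx₂ (by linarith))
      (by
        rw [e, Complex.neg_im, neg_lt_neg_iff, ← h₁]
        exact hf.strictMono_im hx₁ (by linarith))
    refine ⟨-t, ?_⟩
    rw [← neg_neg t, e, Complex.neg_im, neg_lt_neg_iff] at ht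
    exact ht
  obtain ⟨t, ht⟩ := hup
  obtain ⟨t', ht'⟩ := hdown
  have hc : Continuous fun t : ℝ => (f (x₀ + t * Complex.I)).im := by
    rw [continuous_iff_continuousAt]
    intro t
    have := (hf.differentiableAt (x₀ + t * Complex.I) (by simpa using hx₀)).continuousAt
    exact Complex.continuous_im.continuousAt.comp (ContinuousAt.comp (f := fun t : ℝ =>
      (x₀ + t * Complex.I : ℂ)) this (by fun_prop))
  exact mem_range_of_exists_le_of_exists_ge hc ⟨t', ht'.le⟩ ⟨t, ht.le⟩

theorem isPreconnected_level (hf : IsStripMap I f) (s : ℝ) :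
    IsPreconnected {w : ℂ | w.re ∈ I ∧ (f w).im = s} := by
  set J := {x | x ∈ I ∧ ∃ t : ℝ, (f (x + t * Complex.I)).im = s}
  have hJ : J.OrdConnected := hf.ordConnected_level s
  have hex : ∀ x ∈ J, ∃ t : ℝ, (f (x + t * Complex.I)).im = s := fun x hx => hx.2
  choose! τ hτ using hex
  have hτc : ContinuousOn τ J := by
    intro x hx
    have hcx : ∀ t : ℝ, ContinuousAt (fun x : ℝ => (f (x + t * Complex.I)).im) x := by
      intro t
      have := (hf.differentiableAt (x + t * Complex.I) (by simpa using hx.1)).continuousAt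
      exact Complex.continuous_im.continuousAt.comp (ContinuousAt.comp (f := fun x : ℝ =>
        (x + t * Complex.I : ℂ)) this (by fun_prop))
    -- A strict inequality for `Im f` at height `b` persists for nearby abscissae, and by
    -- monotonicity it tells on which side of `b` the level height lies.
    rw [ContinuousWithinAt, tendsto_order]
    constructor
    · intro b hb
      have h1 : (f (x + b * Complex.I)).im < s := by
        rw [← hτ x hx]; exact hf.strictMono_im hx.1 hb
      filter_upwards [self_mem_nhdsWithin,
        mem_nhdsWithin_of_mem_nhds ((hcx b).eventually (gt_mem_nhds h1))] with y hy hy'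
      rw [← hτ y hy] at hy'
      exact (hf.strictMono_im hy.1).lt_iff_lt.1 hy'
    · intro b hb
      have h1 : s < (f (x + b * Complex.I)).im := by
        rw [← hτ x hx]; exact hf.strictMono_im hx.1 hb
      filter_upwards [self_mem_nhdsWithin,
        mem_nhdsWithin_of_mem_nhds ((hcx b).eventually (lt_mem_nhds h1))] with y hy hy'
      rw [← hτ y hy] at hy'
      exact (hf.strictMono_im hy.1).lt_iff_lt.1 hy'
  have himg : {w : ℂ | w.re ∈ I ∧ (f w).im = s} =
      (fun x : ℝ => (x + τ x * Complex.I : ℂ)) '' J := by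
    ext w
    constructor
    · rintro ⟨hw, hws⟩
      have hwJ : w.re ∈ J := ⟨hw, w.im, by rwa [Complex.re_add_im]⟩
      refine ⟨w.re, hwJ, ?_⟩
      have : τ w.re = w.im := (hf.strictMono_im hw).injective (by
        simp only [hτ _ hwJ, Complex.re_add_im, hws])
      simp only [this, Complex.re_add_im]
    · rintro ⟨x, hx, rfl⟩
      exact ⟨by simpa using hx.1, hτ x hx⟩
  rw [himg]
  refine hJ.isPreconnected.image _ ?_
  exact (Complex.continuous_ofReal.continuousOn).add
    ((Complex.continuous_ofReal.comp_continuousOn hτc).mul continuousOn_const)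

/-- Noshiro–Warschawski: along a segment with direction `d`, `Re (conj d * f)` has derivative `|d|²
Re f' > 0`. -/
theorem injOn (hf : IsStripMap I f) : InjOn f {w : ℂ | w.re ∈ I} := by
  intro w₁ h₁ w₂ h₂ h
  by_contra hne
  set d := w₂ - w₁ with hd
  have hd0 : d ≠ 0 := sub_ne_zero.2 (Ne.symm hne)
  have hmem : ∀ t ∈ Icc (0 : ℝ) 1, (w₁ + t * d).re ∈ I := by
    intro t ht
    have := hf.ordConnected.convex h₁ h₂ (sub_nonneg.2 ht.2) ht.1 (by ring)
    convert this using 1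
    simp [hd]
    ring
  have hder : ∀ t ∈ Icc (0 : ℝ) 1, HasDerivAt (fun t : ℝ => (conj d * f (w₁ + t * d)).re)
      (conj d * (deriv f (w₁ + t * d) * d)).re t := by
    intro t ht
    have h1 : HasDerivAt (fun t : ℝ => w₁ + t * d) d t := by
      simpa using ((hasDerivAt_id t).ofReal_comp.mul_const d).const_add w₁
    exact Complex.reCLM.hasFDerivAt.comp_hasDerivAt t
      (((hf.differentiableAt _ (hmem t ht)).hasDerivAt.comp t h1).const_mul (conj d))
  have hmono : StrictMonoOn (fun t : ℝ => (conj d * f (w₁ + t * d)).re) (Icc 0 1) := by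
    refine strictMonoOn_of_deriv_pos (convex_Icc 0 1)
      (fun t ht => (hder t ht).continuousAt.continuousWithinAt) (fun t ht => ?_)
    have ht' := interior_subset ht
    rw [(hder t ht').deriv]
    have : conj d * (deriv f (w₁ + t * d) * d) =
        ((Complex.normSq d : ℝ) : ℂ) * deriv f (w₁ + t * d) := by
      rw [Complex.normSq_eq_conj_mul_self]; ring
    rw [this, Complex.re_ofReal_mul]
    exact mul_pos (Complex.normSq_pos.2 hd0) (hf.re_deriv_pos _ (hmem t ht'))
  have := hmono (left_mem_Icc.2 zero_le_one) (right_mem_Icc.2 zero_le_one) one_pos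
  simp [hd, h] at this

/-- If `F' / f'` has positive real part, then `Re F` is injective on the level sets of `Im f`. -/
theorem eq_of_re_eq (hf : IsStripMap I f) {F : ℂ → ℂ}
    (hF : ∀ w : ℂ, w.re ∈ I → DifferentiableAt ℂ F w)
    (hpos : ∀ w : ℂ, w.re ∈ I → 0 < (deriv F w / deriv f w).re) {w₁ w₂ : ℂ}
    (h₁ : w₁.re ∈ I) (h₂ : w₂.re ∈ I) (him : (f w₁).im = (f w₂).im)
    (hre : (F w₁).re = (F w₂).re) : w₁ = w₂ := by
  set Ω := {w : ℂ | w.re ∈ I} with hΩ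
  have hΩo : IsOpen Ω := hf.isOpen.preimage Complex.continuous_re
  set g := Function.invFunOn f Ω with hg
  have hleft : ∀ w ∈ Ω, g (f w) = w := fun w hw => hf.injOn.leftInvOn_invFunOn hw
  have hne : ∀ w ∈ Ω, deriv f w ≠ 0 := fun w hw h0 => by
    have := hf.re_deriv_pos w hw
    simp [h0] at this
  have hgd : ∀ w ∈ Ω, HasDerivAt g (deriv f w)⁻¹ (f w) := by
    intro w hw
    have han : AnalyticAt ℂ f w := DifferentiableOn.analyticAt (s := Ω)
      (fun z hz => (hf.differentiableAt z hz).differentiableWithinAt) (hΩo.mem_nhds hw)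
    have hst : HasStrictDerivAt f (deriv f w) w := han.hasStrictDerivAt
    have hmap := hst.map_nhds_eq (hne w hw)
    have hev : ∀ᶠ z in 𝓝 w, g (f z) = z := by
      filter_upwards [hΩo.mem_nhds hw] with z hz using hleft z hz
    have hcont : ContinuousAt g (f w) := by
      rw [ContinuousAt, hleft w hw, ← hmap, tendsto_map'_iff]
      exact tendsto_id.congr' (hev.mono fun z hz => hz.symm)
    refine HasDerivAt.of_local_left_inverse (f := f) hcont ?_ (hne w hw) ?_
    · rw [hleft w hw]; exact hst.hasDerivAt
    · rw [← hmap, eventually_map]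
      exact hev.mono fun z hz => by rw [hz]
  set s := (f w₁).im with hs
  set A : Set ℝ := (fun w => (f w).re) '' {w : ℂ | w.re ∈ I ∧ (f w).im = s} with hA
  -- Connectedness of the level set enters here: `Re f` takes an interval of values on it, so the
  -- sign of a derivative yields monotonicity.
  have hAc : Convex ℝ A := by
    refine IsPreconnected.convex ((hf.isPreconnected_level s).image _ ?_)
    exact fun w hw => (Complex.continuous_re.continuousAt.comp
      (hf.differentiableAt w hw.1).continuousAt).continuousWithinAt
  have hder : ∀ w : ℂ, w.re ∈ I → (f w).im = s →
      HasDerivAt (fun r : ℝ => (F (g (r + s * Complex.I))).re) (deriv F w / deriv f w).re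
        (f w).re := by
    intro w hw hws
    have e : ((f w).re + s * Complex.I : ℂ) = f w := by rw [← hws, Complex.re_add_im]
    have h1 : HasDerivAt (fun r : ℝ => (r + s * Complex.I : ℂ)) 1 (f w).re := by
      simpa using (hasDerivAt_id (f w).re).ofReal_comp.add_const (s * Complex.I : ℂ)
    have h2 : HasDerivAt g (deriv f w)⁻¹ ((fun r : ℝ => (r + s * Complex.I : ℂ)) (f w).re) := by
      simp only [e]; exact hgd w hw
    have h3 : HasDerivAt (fun r : ℝ => g (r + s * Complex.I)) ((deriv f w)⁻¹ * 1) (f w).re :=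
      HasDerivAt.comp (f w).re (h₂ := g) (h := fun r : ℝ => (r + s * Complex.I : ℂ)) h2 h1
    have h4 : HasDerivAt F (deriv F w) (g ((f w).re + s * Complex.I)) := by
      rw [e, hleft w hw]; exact (hF w hw).hasDerivAt
    have h5 := HasDerivAt.comp (f w).re (h := fun r : ℝ => g (r + s * Complex.I)) h4 h3
    have h6 := Complex.reCLM.hasFDerivAt.comp_hasDerivAt (f w).re h5
    rw [mul_one, ← div_eq_mul_inv] at h6
    exact h6
  have hmono : StrictMonoOn (fun r : ℝ => (F (g (r + s * Complex.I))).re) A := by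
    refine strictMonoOn_of_deriv_pos hAc ?_ ?_
    · rintro _ ⟨w, hw, rfl⟩
      exact (hder w hw.1 hw.2).continuousAt.continuousWithinAt
    · intro r hr
      obtain ⟨w, hw, rfl⟩ := interior_subset hr
      rw [(hder w hw.1 hw.2).deriv]
      exact hpos w hw.1
  have e₁ : ((f w₁).re + s * Complex.I : ℂ) = f w₁ := Complex.re_add_im _
  have e₂ : ((f w₂).re + s * Complex.I : ℂ) = f w₂ := by rw [him, Complex.re_add_im]
  have h := hmono.injOn ⟨w₁, ⟨h₁, rfl⟩, rfl⟩ ⟨w₂, ⟨h₂, him.symm⟩, rfl⟩ (by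
    simp only [e₁, e₂, hleft w₁ h₁, hleft w₂ h₂, hre])
  exact hf.injOn h₁ h₂ (Complex.ext h him)

end IsStripMap

/-! ### The shear argument -/

theorem re_div_pos_iff {z w : ℂ} (hw : w ≠ 0) : 0 < (z / w).re ↔ 0 < (z * conj w).re := by
  have h : z / w = ((Complex.normSq w)⁻¹ : ℝ) * (z * conj w) := by
    rw [div_eq_mul_inv, Complex.inv_def]; push_cast; ring
  rw [h, Complex.re_ofReal_mul]
  exact mul_pos_iff_of_pos_left (inv_pos.2 (Complex.normSq_pos.2 hw))

theorem re_add_div_sub_pos {z w : ℂ} (h : ‖w‖ < ‖z‖) : 0 < ((z + w) / (z - w)).re := by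
  have hne : z - w ≠ 0 := by
    intro h0
    rw [sub_eq_zero.1 h0] at h
    exact lt_irrefl _ h
  rw [re_div_pos_iff hne]
  have h1 : ‖w‖ ^ 2 < ‖z‖ ^ 2 := by gcongr
  rw [← Complex.normSq_eq_norm_sq, ← Complex.normSq_eq_norm_sq, Complex.normSq_apply,
    Complex.normSq_apply] at h1
  simp only [map_sub, Complex.mul_re, Complex.add_re, Complex.sub_re, Complex.add_im,
    Complex.sub_im, Complex.conj_re, Complex.conj_im]
  nlinarith

/-- A shear construction: if the disc is the image of a vertical strip under `V` and
`(p - q) ∘ V` has a derivative with positive real part, then the harmonic map `p + conj q` is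
injective and its image meets horizontal lines in connected sets. -/
theorem injOn_and_isPreconnected_of_strip {p q V V' : ℂ → ℂ} {I : Set ℝ}
    (hp : DifferentiableOn ℂ p unitDisc) (hq : DifferentiableOn ℂ q unitDisc)
    (hlt : ∀ v ∈ unitDisc, ‖deriv q v‖ < ‖deriv p v‖) (hIo : IsOpen I) (hIc : I.OrdConnected)
    (hV : ∀ w : ℂ, w.re ∈ I → HasDerivAt V (V' w) w)
    (hmaps : ∀ w : ℂ, w.re ∈ I → V w ∈ unitDisc)
    (hsurj : ∀ v ∈ unitDisc, ∃ w : ℂ, w.re ∈ I ∧ V w = v)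
    (hpos : ∀ w : ℂ, w.re ∈ I → 0 < ((deriv p (V w) - deriv q (V w)) * V' w).re) :
    InjOn (fun v => p v + conj (q v)) unitDisc ∧
      ∀ s : ℝ, IsPreconnected ((fun v => p v + conj (q v)) '' unitDisc ∩ {ζ | ζ.im = s}) := by
  have hf : ∀ w : ℂ, w.re ∈ I → HasDerivAt (fun w => p (V w) - q (V w))
      ((deriv p (V w) - deriv q (V w)) * V' w) w := by
    intro w hw
    rw [sub_mul]
    exact ((hp.differentiableAt_unitDisc (hmaps w hw)).hasDerivAt.comp w (hV w hw)).sub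
      ((hq.differentiableAt_unitDisc (hmaps w hw)).hasDerivAt.comp w (hV w hw))
  have hF : ∀ w : ℂ, w.re ∈ I → HasDerivAt (fun w => p (V w) + q (V w))
      ((deriv p (V w) + deriv q (V w)) * V' w) w := by
    intro w hw
    rw [add_mul]
    exact ((hp.differentiableAt_unitDisc (hmaps w hw)).hasDerivAt.comp w (hV w hw)).add
      ((hq.differentiableAt_unitDisc (hmaps w hw)).hasDerivAt.comp w (hV w hw))
  have hstrip : IsStripMap I fun w => p (V w) - q (V w) :=
    ⟨hIo, hIc, fun w hw => (hf w hw).differentiableAt, fun w hw => by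
      rw [(hf w hw).deriv]; exact hpos w hw⟩
  have him : ∀ v, (p v + conj (q v)).im = (p v - q v).im := fun v => by simp [sub_eq_add_neg]
  have hre : ∀ v, (p v + conj (q v)).re = (p v + q v).re := fun v => by simp
  constructor
  · intro v₁ hv₁ v₂ hv₂ h
    obtain ⟨w₁, hw₁, rfl⟩ := hsurj v₁ hv₁
    obtain ⟨w₂, hw₂, rfl⟩ := hsurj v₂ hv₂
    refine congrArg V (hstrip.eq_of_re_eq (fun w hw => (hF w hw).differentiableAt)
      (fun w hw => ?_) hw₁ hw₂ ?_ ?_)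
    · have hV0 : V' w ≠ 0 := fun h0 => by
        have := hpos w hw
        simp [h0] at this
      rw [(hF w hw).deriv, (hf w hw).deriv, mul_div_mul_right _ _ hV0]
      exact re_add_div_sub_pos (hlt _ (hmaps w hw))
    · rw [← him, ← him]; exact congrArg Complex.im h
    · rw [← hre, ← hre]; exact congrArg Complex.re h
  · intro s
    have himg : (fun v => p v + conj (q v)) '' unitDisc ∩ {ζ | ζ.im = s} =
        (fun w => p (V w) + conj (q (V w))) ''
          {w : ℂ | w.re ∈ I ∧ (p (V w) - q (V w)).im = s} := by
      ext ζ
      constructor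
      · rintro ⟨⟨v, hv, rfl⟩, hs⟩
        obtain ⟨w, hw, rfl⟩ := hsurj v hv
        exact ⟨w, ⟨hw, by rw [← him]; exact hs⟩, rfl⟩
      · rintro ⟨w, ⟨hw, hs⟩, rfl⟩
        exact ⟨⟨V w, hmaps w hw, rfl⟩, by rw [← hs, ← him]; rfl⟩
    rw [himg]
    refine (hstrip.isPreconnected_level s).image _ fun w hw => ContinuousAt.continuousWithinAt ?_
    have hVc := (hV w hw.1).continuousAt
    exact ((hp.differentiableAt_unitDisc (hmaps w hw.1)).continuousAt.comp hVc).add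
      (Complex.continuous_conj.continuousAt.comp
        ((hq.differentiableAt_unitDisc (hmaps w hw.1)).continuousAt.comp hVc))

/-! ### Strip parametrizations of the disc -/

theorem exists_strip_param_of_sin_pos {η : ℝ} (hη : 0 < Real.sin η) :
    ∃ (I : Set ℝ) (V : ℂ → ℂ) (k : ℝ), IsOpen I ∧ I.OrdConnected ∧ 0 < k ∧
      (∀ w : ℂ, w.re ∈ I → HasDerivAt V (k * (1 + 2 * V w * Real.cos η + V w ^ 2)) w) ∧
      (∀ w : ℂ, w.re ∈ I → V w ∈ unitDisc) ∧
      ∀ v ∈ unitDisc, ∃ w : ℂ, w.re ∈ I ∧ V w = v := by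
  set c := Real.cos η with hc
  set σ := Real.sin η with hσ
  have hcσ : σ ^ 2 + c ^ 2 = 1 := Real.sin_sq_add_cos_sq η
  have hcσ' : (σ : ℂ) ^ 2 + (c : ℂ) ^ 2 = 1 := by exact_mod_cast hcσ
  set κ : ℂ := c - σ * Complex.I with hκ
  have hκn : ‖κ‖ = 1 := by
    rw [← sq_eq_sq₀ (norm_nonneg _) zero_le_one, ← Complex.normSq_eq_norm_sq, Complex.normSq_apply]
    simp [hκ]; nlinarith
  have hκ2 : κ ^ 2 = 2 * c * κ - 1 := by
    rw [hκ]; linear_combination (-1 : ℂ) * hcσ' + (σ : ℂ) ^ 2 * Complex.I_sq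
  have hlt : ∀ N : ℂ, 0 < N.re → ‖Complex.I * κ - N‖ < ‖N * κ - Complex.I‖ := by
    intro N hN
    rw [← sq_lt_sq₀ (norm_nonneg _) (norm_nonneg _), ← Complex.normSq_eq_norm_sq,
      ← Complex.normSq_eq_norm_sq, Complex.normSq_apply, Complex.normSq_apply]
    simp [hκ]
    have h1 : (N.re ^ 2 + N.im ^ 2) * (σ ^ 2 + c ^ 2) = N.re ^ 2 + N.im ^ 2 := by
      rw [hcσ, mul_one]
    nlinarith [mul_pos hN hη]
  have hden : ∀ N : ℂ, 0 < N.re → N * κ - Complex.I ≠ 0 := fun N hN => by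
    have := (norm_nonneg _).trans_lt (hlt N hN)
    exact norm_pos_iff.1 this
  have hN : ∀ w : ℂ, w.re ∈ Ioo (-(Real.pi / 2)) (Real.pi / 2) →
      0 < (Complex.exp (w * Complex.I)).re := by
    intro w hw
    rw [Complex.exp_re]
    simp only [Complex.mul_I_re, Complex.mul_I_im]
    exact mul_pos (Real.exp_pos _) (Real.cos_pos_of_mem_Ioo hw)
  -- `N = exp (iw)` maps the strip onto the right half-plane, and a Möbius map takes that to the
  -- disc, sending `N = 0` and `N = ∞` to `-κ` and `-κ⁻¹`, the zeros of `1 + 2cv + v²`.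
  refine ⟨Ioo (-(Real.pi / 2)) (Real.pi / 2), fun w =>
    (Complex.I * κ - Complex.exp (w * Complex.I)) / (Complex.exp (w * Complex.I) * κ - Complex.I),
    (2 * σ)⁻¹, isOpen_Ioo, ordConnected_Ioo, by positivity, ?_, ?_, ?_⟩
  · intro w hw
    have hd := hden _ (hN w hw)
    have h1 : HasDerivAt (fun w : ℂ => Complex.exp (w * Complex.I))
        (Complex.exp (w * Complex.I) * Complex.I) w := by
      simpa using ((hasDerivAt_id w).mul_const Complex.I).cexp
    have h2 := (h1.const_sub (Complex.I * κ)).div ((h1.mul_const κ).sub_const Complex.I) hd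
    refine h2.congr_deriv ?_
    set N := Complex.exp (w * Complex.I)
    have hσ0 : (σ : ℂ) ≠ 0 := by exact_mod_cast hη.ne'
    have e1 : κ * (c + σ * Complex.I) = 1 := by
      rw [hκ]; linear_combination hcσ' - (σ : ℂ) ^ 2 * Complex.I_sq
    have e2 : -4 * κ * Complex.I + 2 * c * Complex.I * (κ ^ 2 + 1) = 2 * σ * (κ ^ 2 - 1) := by
      rw [hκ2]
      linear_combination 4 * Complex.I * κ * hcσ' - 4 * σ * e1
    have e3 : (N * κ - Complex.I) ^ 2 + 2 * (Complex.I * κ - N) * c * (N * κ - Complex.I) +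
        (Complex.I * κ - N) ^ 2 = 2 * σ * (N * (κ ^ 2 - 1)) := by
      linear_combination N * e2 + (N ^ 2 - 1) * hκ2 + (1 - 2 * c * κ + κ ^ 2) * Complex.I_sq
    have e4 : -(N * Complex.I) * (N * κ - Complex.I) -
        (Complex.I * κ - N) * (N * Complex.I * κ) = N * (κ ^ 2 - 1) := by
      linear_combination N * (1 - κ ^ 2) * Complex.I_sq
    change _ = (((2 * σ)⁻¹ : ℝ) : ℂ) * (1 + 2 * ((Complex.I * κ - N) / (N * κ - Complex.I)) * c +
      ((Complex.I * κ - N) / (N * κ - Complex.I)) ^ 2)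
    rw [e4, ← mul_div_cancel_left₀ (N * (κ ^ 2 - 1)) (mul_ne_zero two_ne_zero hσ0), ← e3]
    push_cast
    field_simp
  · intro w hw
    rw [mem_unitDisc_iff, norm_div, div_lt_one (norm_pos_iff.2 (hden _ (hN w hw)))]
    exact hlt _ (hN w hw)
  · intro v hv
    rw [mem_unitDisc_iff] at hv
    have hvκ : 1 + v * κ ≠ 0 := by
      intro h0
      have h1 : ‖v * κ‖ = 1 := by
        rw [show v * κ = -1 by linear_combination h0]; simp
      rw [norm_mul, hκn, mul_one] at h1
      linarith
    set N := Complex.I * (κ + v) / (1 + v * κ) with hNdef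
    have hNre : 0 < N.re := by
      rw [hNdef, re_div_pos_iff hvκ]
      have hv2 : v.re ^ 2 + v.im ^ 2 < 1 := by
        have : ‖v‖ ^ 2 < 1 := by nlinarith [norm_nonneg v]
        rw [← Complex.normSq_eq_norm_sq, Complex.normSq_apply] at this
        nlinarith
      have : (Complex.I * (κ + v) * conj (1 + v * κ)).re = σ * (1 - (v.re ^ 2 + v.im ^ 2)) := by
        simp [hκ]
        linear_combination v.im * hcσ
      rw [this]
      exact mul_pos hη (by linarith)
    have hN0 : N ≠ 0 := fun h => by simp [h] at hNre
    refine ⟨-Complex.I * Complex.log N, ?_, ?_⟩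
    · have : (-Complex.I * Complex.log N).re = N.arg := by simp [Complex.log_im]
      rw [this]
      exact abs_lt.1 (Complex.abs_arg_lt_pi_div_two_iff.2 (Or.inl hNre))
    · have e : -Complex.I * Complex.log N * Complex.I = Complex.log N := by
        linear_combination (-Complex.log N) * Complex.I_sq
      simp only [e, Complex.exp_log hN0]
      rw [div_eq_iff (hden N hNre)]
      have : N * (1 + v * κ) = Complex.I * (κ + v) := div_mul_cancel₀ _ hvκ
      linear_combination -this

theorem exists_strip_param_of_sq_eq_one {ε : ℝ} (hε : ε ^ 2 = 1) :
    ∃ (I : Set ℝ) (V : ℂ → ℂ) (k : ℝ), IsOpen I ∧ I.OrdConnected ∧ 0 < k ∧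
      (∀ w : ℂ, w.re ∈ I → HasDerivAt V (k * (1 + 2 * V w * ε + V w ^ 2)) w) ∧
      (∀ w : ℂ, w.re ∈ I → V w ∈ unitDisc) ∧
      ∀ v ∈ unitDisc, ∃ w : ℂ, w.re ∈ I ∧ V w = v := by
  have hε' : (ε : ℂ) ^ 2 = 1 := by exact_mod_cast hε
  have hlt : ∀ w : ℂ, ‖w‖ < ‖1 - ε * w‖ ↔ 2 * (ε * w.re) < 1 := by
    intro w
    rw [← sq_lt_sq₀ (norm_nonneg _) (norm_nonneg _), ← Complex.normSq_eq_norm_sq,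
      ← Complex.normSq_eq_norm_sq, Complex.normSq_apply, Complex.normSq_apply]
    simp
    constructor <;> intro h <;> nlinarith
  have hden : ∀ w : ℂ, 2 * (ε * w.re) < 1 → 1 - ε * w ≠ 0 := fun w hw =>
    norm_pos_iff.1 ((norm_nonneg _).trans_lt ((hlt w).2 hw))
  -- Here the quadratic is `(1 + εv)²`, and integrating `V' = (1 + εV)²` with `V 0 = 0` gives `w/(1
  -- - εw)`. The strip degenerates to the half-plane `|w| < |1 - εw|`.
  refine ⟨{x | 2 * (ε * x) < 1}, fun w => w / (1 - ε * w), 1,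
    isOpen_lt (by fun_prop) continuous_const, ?_, one_pos, ?_, ?_, ?_⟩
  · refine Convex.ordConnected fun x hx y hy s t hs ht hst => ?_
    simp only [mem_ofPred_eq, smul_eq_mul] at *
    have : 2 * (ε * (s * x + t * y)) = s * (2 * (ε * x)) + t * (2 * (ε * y)) := by ring
    rw [this]
    exact convex_Iio (1 : ℝ) hx hy hs ht hst
  · intro w hw
    have hd := hden w hw
    have h1 : HasDerivAt (fun w : ℂ => 1 - ε * w) (-ε) w := by
      simpa using ((hasDerivAt_id w).const_mul (ε : ℂ)).const_sub 1
    refine ((hasDerivAt_id w).div h1 hd).congr_deriv ?_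
    simp only [id, Complex.ofReal_one]
    field_simp
    linear_combination w ^ 2 * hε'
  · intro w hw
    rw [mem_unitDisc_iff, norm_div, div_lt_one (norm_pos_iff.2 (hden w hw))]
    exact (hlt w).2 hw
  · intro v hv
    rw [mem_unitDisc_iff] at hv
    have hne : 1 + ε * v ≠ 0 := by
      intro h0
      have h1 : ‖(ε : ℂ) * v‖ = 1 := by
        rw [show (ε : ℂ) * v = -1 by linear_combination h0]; simp
      have h2 : ‖(ε : ℂ)‖ = 1 := by
        have := congrArg norm hε'
        rw [norm_pow, norm_one] at this
        exact (pow_eq_one_iff_of_nonneg (norm_nonneg _) two_ne_zero).1 this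
      rw [norm_mul, h2, one_mul] at h1
      linarith
    have e : 1 - ε * (v / (1 + ε * v)) = 1 / (1 + ε * v) := by field_simp; ring
    refine ⟨v / (1 + ε * v), ?_, ?_⟩
    · refine (hlt _).1 ?_
      rw [e, norm_div, norm_div, norm_one]
      gcongr
    · change v / (1 + ε * v) / (1 - ε * (v / (1 + ε * v))) = v
      rw [e, div_div_div_cancel_right₀ hne, div_one]

theorem exists_strip_param (η : ℝ) :
    ∃ (I : Set ℝ) (V : ℂ → ℂ) (k : ℝ), IsOpen I ∧ I.OrdConnected ∧ 0 < k ∧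
      (∀ w : ℂ, w.re ∈ I → HasDerivAt V (k * (1 + 2 * V w * Real.cos η + V w ^ 2)) w) ∧
      (∀ w : ℂ, w.re ∈ I → V w ∈ unitDisc) ∧
      ∀ v ∈ unitDisc, ∃ w : ℂ, w.re ∈ I ∧ V w = v := by
  rcases lt_trichotomy (Real.sin η) 0 with h | h | h
  -- Only `cos η` matters, so `η` may be replaced by `-η`.
  · have := exists_strip_param_of_sin_pos (η := -η) (by rw [Real.sin_neg]; linarith)
    rwa [Real.cos_neg] at this
  · exact exists_strip_param_of_sq_eq_one (by
      have := Real.sin_sq_add_cos_sq η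
      rw [h] at this
      linarith)
  · exact exists_strip_param_of_sin_pos h

/-! ### Derivative estimates for the monomial shear -/

theorem re_one_sub_div_one_add_pos {z : ℂ} (hz : ‖z‖ < 1) : 0 < ((1 - z) / (1 + z)).re := by
  have := re_add_div_sub_pos (z := 1) (w := -z) (by simpa using hz)
  simpa [← sub_eq_add_neg] using this

theorem re_mul_conj_quadratic_pos {v : ℂ} (hv : v ∈ unitDisc) {b : ℝ} (hb : |b| ≤ 1) :
    0 < ((1 - v ^ 2) * conj (1 + 2 * v * b + v ^ 2)).re := by
  rw [mem_unitDisc_iff] at hv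
  have h1 : v.re ^ 2 + v.im ^ 2 = ‖v‖ ^ 2 := by
    rw [← Complex.normSq_eq_norm_sq, Complex.normSq_apply]; ring
  have h2 : ((1 - v ^ 2) * conj (1 + 2 * v * b + v ^ 2)).re =
      (1 - ‖v‖ ^ 2) * (1 + ‖v‖ ^ 2 + 2 * (v.re * b)) := by
    rw [← h1]
    simp [pow_two]
    ring
  have h3 : |v.re * b| ≤ ‖v‖ := by
    rw [abs_mul]
    calc |v.re| * |b| ≤ ‖v‖ * 1 := by
          gcongr
          exact Complex.abs_re_le_norm v
      _ = ‖v‖ := mul_one _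
  rw [h2]
  have h4 := (abs_le.1 h3).1
  refine mul_pos ?_ ?_ <;> nlinarith [norm_nonneg v]

theorem quadratic_ne_zero {v : ℂ} (hv : v ∈ unitDisc) {b : ℝ} (hb : |b| ≤ 1) :
    1 + 2 * v * b + v ^ 2 ≠ 0 := fun h => by
  have := re_mul_conj_quadratic_pos hv hb
  rw [h] at this
  simp at this

/-- The analytic and co-analytic parts of a harmonic map with `R' + S' = (1 + 2bz + z²)⁻¹` and
dilatation `ζ zⁿ`. -/
structure IsMonomialShear (b : ℝ) (n : ℕ) (ζ : ℂ) (R S : ℂ → ℂ) : Prop where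
  analytic_R : DifferentiableOn ℂ R unitDisc
  analytic_S : DifferentiableOn ℂ S unitDisc
  norm_eq_one : ‖ζ‖ = 1
  abs_le_one : |b| ≤ 1
  ne_zero : n ≠ 0
  deriv_add : ∀ v ∈ unitDisc, deriv R v + deriv S v = (1 + 2 * v * b + v ^ 2)⁻¹
  dilatation : ∀ v ∈ unitDisc, deriv S v = ζ * v ^ n * deriv R v

namespace IsMonomialShear

variable {b : ℝ} {n : ℕ} {ζ : ℂ} {R S : ℂ → ℂ}

theorem norm_lt_one (h : IsMonomialShear b n ζ R S) {v : ℂ} (hv : v ∈ unitDisc) :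
    ‖ζ * v ^ n‖ < 1 := by
  rw [mem_unitDisc_iff] at hv
  rw [norm_mul, h.norm_eq_one, one_mul, norm_pow]
  exact pow_lt_one₀ (norm_nonneg _) hv h.ne_zero

theorem one_add_ne_zero (h : IsMonomialShear b n ζ R S) {v : ℂ} (hv : v ∈ unitDisc) :
    1 + ζ * v ^ n ≠ 0 := fun h0 => by
  have h1 := h.norm_lt_one hv
  rw [show ζ * v ^ n = -1 by linear_combination h0] at h1
  simp at h1

theorem deriv_R (h : IsMonomialShear b n ζ R S) {v : ℂ} (hv : v ∈ unitDisc) :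
    deriv R v = ((1 + 2 * v * b + v ^ 2) * (1 + ζ * v ^ n))⁻¹ := by
  have h1 := h.deriv_add v hv
  rw [h.dilatation v hv] at h1
  rw [mul_inv, ← h1]
  have := h.one_add_ne_zero hv
  field_simp

theorem mul_deriv_monomial (v ζ : ℂ) (hn : n ≠ 0) :
    v * (ζ * (n * v ^ (n - 1))) = n * (ζ * v ^ n) := by
  obtain ⟨m, rfl⟩ := Nat.exists_eq_succ_of_ne_zero hn
  simp only [Nat.succ_eq_add_one, Nat.add_sub_cancel]
  ring

/-- The logarithmic derivative of `R' = 1/(d(1+ω))`, arranged so that only constants and functions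
of positive real part occur. -/
theorem exists_hasDerivAt_deriv_R (h : IsMonomialShear b n ζ R S) {v : ℂ} (hv : v ∈ unitDisc) :
    ∃ r, HasDerivAt (deriv R) r v ∧ v * r = deriv R v *
      (-1 + (1 - v ^ 2) / (1 + 2 * v * b + v ^ 2) - n / 2 +
        n / 2 * ((1 - ζ * v ^ n) / (1 + ζ * v ^ n))) := by
  have hd := quadratic_ne_zero hv h.abs_le_one
  have hω := h.one_add_ne_zero hv
  have h1 : HasDerivAt (fun v : ℂ => 1 + 2 * v * b + v ^ 2) (2 * b + 2 * v) v := by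
    have := ((((hasDerivAt_id v).const_mul 2).mul_const (b : ℂ)).const_add 1).add
      (hasDerivAt_pow 2 v)
    refine this.congr_deriv ?_
    simp
  have h2 : HasDerivAt (fun v : ℂ => 1 + ζ * v ^ n) (ζ * (n * v ^ (n - 1))) v :=
    ((hasDerivAt_pow n v).const_mul ζ).const_add 1
  have h3 : HasDerivAt (fun v : ℂ => ((1 + 2 * v * b + v ^ 2) * (1 + ζ * v ^ n))⁻¹)
      (-((2 * b + 2 * v) * (1 + ζ * v ^ n) + (1 + 2 * v * b + v ^ 2) * (ζ * (n * v ^ (n - 1)))) /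
        ((1 + 2 * v * b + v ^ 2) * (1 + ζ * v ^ n)) ^ 2) v :=
    (h1.mul h2).inv (mul_ne_zero hd hω)
  refine ⟨_, h3.congr_of_eventuallyEq ?_, ?_⟩
  · filter_upwards [isOpen_unitDisc.mem_nhds hv] with w hw using h.deriv_R hw
  · have e := mul_deriv_monomial (n := n) v ζ h.ne_zero
    rw [h.deriv_R hv]
    generalize ζ * (n * v ^ (n - 1)) = ω' at *
    generalize ζ * v ^ n = ω at *
    set d := 1 + 2 * v * b + v ^ 2 with hdd
    have e2 : v * (2 * b + 2 * v) = 2 * d - 2 - 2 * v * b := by rw [hdd]; ring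
    have e3 : 1 - v ^ 2 = 2 - d + 2 * v * b := by rw [hdd]; ring
    rw [e3]
    field_simp
    linear_combination (-2 * d) * e - 2 * (1 + ω) * e2

variable {c : ℝ}

/-- The term `nω` from differentiating the dilatation turns the constant `1 + cn/2` of the second
derivative into `1 - cn/2`. The two derivatives thus differ, apart from `ω`, only in the sign of
`c(Y + (n/2)Z)`. -/
theorem exists_hasDerivAt (h : IsMonomialShear b n ζ R S) (c : ℝ) {v : ℂ}
    (hv : v ∈ unitDisc) :
    ∃ Y Z : ℂ, 0 < Y.re ∧ 0 < Z.re ∧ Y = (1 - v ^ 2) / (1 + 2 * v * b + v ^ 2) ∧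
      Z = (1 - ζ * v ^ n) / (1 + ζ * v ^ n) ∧
      HasDerivAt (fun v => R v + c * (v * deriv R v))
        (deriv R v * ((1 - c * n / 2) + c * (Y + n / 2 * Z))) v ∧
      HasDerivAt (fun v => S v - c * (v * deriv S v))
        (ζ * v ^ n * deriv R v * ((1 - c * n / 2) - c * (Y + n / 2 * Z))) v := by
  obtain ⟨r, hr, hvr⟩ := h.exists_hasDerivAt_deriv_R hv
  refine ⟨_, _, ?_, ?_, rfl, rfl, ?_, ?_⟩
  · exact (re_div_pos_iff (quadratic_ne_zero hv h.abs_le_one)).2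
      (re_mul_conj_quadratic_pos hv h.abs_le_one)
  · exact re_one_sub_div_one_add_pos (h.norm_lt_one hv)
  · refine ((h.analytic_R.differentiableAt_unitDisc hv).hasDerivAt.add
      (((hasDerivAt_id v).mul hr).const_mul (c : ℂ))).congr_deriv ?_
    simp only [id]
    rw [hvr]
    ring
  · have hS : HasDerivAt (deriv S) (ζ * (n * v ^ (n - 1)) * deriv R v + ζ * v ^ n * r) v := by
      refine (((hasDerivAt_pow n v).const_mul ζ).mul hr).congr_of_eventuallyEq ?_
      filter_upwards [isOpen_unitDisc.mem_nhds hv] with w hw using h.dilatation w hw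
    refine ((h.analytic_S.differentiableAt_unitDisc hv).hasDerivAt.sub
      (((hasDerivAt_id v).mul hS).const_mul (c : ℂ))).congr_deriv ?_
    have e := mul_deriv_monomial (n := n) v ζ h.ne_zero
    simp only [id]
    linear_combination (1 - c) * h.dilatation v hv - c * deriv R v * e - c * (ζ * v ^ n) * hvr

theorem norm_deriv_lt (h : IsMonomialShear b n ζ R S) (hc : 0 < c) (hcn : c * n ≤ 2) {v : ℂ}
    (hv : v ∈ unitDisc) :
    ‖deriv (fun v => S v - c * (v * deriv S v)) v‖ <
      ‖deriv (fun v => R v + c * (v * deriv R v)) v‖ := by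
  obtain ⟨Y, Z, hY, hZ, -, -, hp, hq⟩ := h.exists_hasDerivAt c hv
  rw [hp.deriv, hq.deriv]
  have hR0 : deriv R v ≠ 0 := by
    rw [h.deriv_R hv]
    exact inv_ne_zero (mul_ne_zero (quadratic_ne_zero hv h.abs_le_one) (h.one_add_ne_zero hv))
  set B : ℂ := c * (Y + n / 2 * Z) with hB
  have hBre : 0 < B.re := by
    have : B = (c : ℝ) * (Y + ((n / 2 : ℝ) : ℂ) * Z) := by rw [hB]; push_cast; ring
    rw [this, Complex.re_ofReal_mul, Complex.add_re, Complex.re_ofReal_mul]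
    positivity
  set m : ℝ := 1 - c * n / 2 with hm
  have hm0 : 0 ≤ m := by rw [hm]; linarith
  have hmc : (1 - c * n / 2 : ℂ) = m := by rw [hm]; push_cast; ring
  rw [hmc]
  -- For real `m ≥ 0` and `Re B > 0`, the point `B` is no farther from `m` than from `-m`.
  have hle : ‖(m : ℂ) - B‖ ≤ ‖(m : ℂ) + B‖ := by
    rw [← sq_le_sq₀ (norm_nonneg _) (norm_nonneg _), ← Complex.normSq_eq_norm_sq,
      ← Complex.normSq_eq_norm_sq, Complex.normSq_apply, Complex.normSq_apply]
    simp
    nlinarith [mul_nonneg hm0 hBre.le]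
  have hpos : 0 < ‖(m : ℂ) + B‖ := by
    refine norm_pos_iff.2 fun h0 => ?_
    have := congrArg Complex.re h0
    simp at this
    linarith
  rw [norm_mul, norm_mul, norm_mul (deriv R v)]
  have hRp : 0 < ‖deriv R v‖ := norm_pos_iff.2 hR0
  calc ‖ζ * v ^ n‖ * ‖deriv R v‖ * ‖(m : ℂ) - B‖
      ≤ ‖ζ * v ^ n‖ * ‖deriv R v‖ * ‖(m : ℂ) + B‖ := by gcongr
    _ = ‖ζ * v ^ n‖ * (‖deriv R v‖ * ‖(m : ℂ) + B‖) := by ring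
    _ < 1 * (‖deriv R v‖ * ‖(m : ℂ) + B‖) := by
        gcongr
        exact h.norm_lt_one hv
    _ = _ := one_mul _

theorem injOn_and_isPreconnected (h : IsMonomialShear b n ζ R S) (hc : 0 < c) (hcn : c * n ≤ 2) :
    InjOn (fun v => (R v + c * (v * deriv R v)) + conj (S v - c * (v * deriv S v))) unitDisc ∧
      ∀ s : ℝ, IsPreconnected ((fun v => (R v + c * (v * deriv R v)) +
        conj (S v - c * (v * deriv S v))) '' unitDisc ∩ {ζ | ζ.im = s}) := by
  obtain ⟨I, V, k, hIo, hIc, hk, hV, hmaps, hsurj⟩ := exists_strip_param (Real.arccos b)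
  rw [Real.cos_arccos (abs_le.1 h.abs_le_one).1 (abs_le.1 h.abs_le_one).2] at hV
  refine injOn_and_isPreconnected_of_strip (p := fun v => R v + c * (v * deriv R v))
    (q := fun v => S v - c * (v * deriv S v)) ?_ ?_ (fun v hv => h.norm_deriv_lt hc hcn hv)
    hIo hIc hV hmaps hsurj ?_
  · intro v hv
    obtain ⟨Y, Z, -, -, -, -, hp, -⟩ := h.exists_hasDerivAt c hv
    exact hp.differentiableAt.differentiableWithinAt
  · intro v hv
    obtain ⟨Y, Z, -, -, -, -, -, hq⟩ := h.exists_hasDerivAt c hv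
    exact hq.differentiableAt.differentiableWithinAt
  · intro w hw
    have hv := hmaps w hw
    obtain ⟨Y, Z, hY, hZ, -, hZe, hp, hq⟩ := h.exists_hasDerivAt c hv
    rw [hp.deriv, hq.deriv]
    have hd := quadratic_ne_zero hv h.abs_le_one
    have hω := h.one_add_ne_zero hv
    -- Dividing by `1 + ω` turns `(1-ω)m + (1+ω)B` into `mZ + B`, and the `cn/2` terms cancel,
    -- leaving `Z + cY`.
    have key : (deriv R (V w) * ((1 - c * n / 2) + c * (Y + n / 2 * Z)) -
        ζ * V w ^ n * deriv R (V w) * ((1 - c * n / 2) - c * (Y + n / 2 * Z))) *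
        (k * (1 + 2 * V w * b + V w ^ 2)) = (k : ℝ) * (Z + (c : ℝ) * Y) := by
      have hZe' : 1 - ζ * V w ^ n = Z * (1 + ζ * V w ^ n) := by
        rw [hZe, div_mul_cancel₀ _ hω]
      rw [h.deriv_R hv]
      field_simp
      linear_combination k * (2 - c * n) * hZe'
    rw [key, Complex.re_ofReal_mul, Complex.add_re, Complex.re_ofReal_mul]
    positivity

end IsMonomialShear

/-! ### Reduction by rotation and the main theorem -/

theorem mul_mem_unitDisc {u z : ℂ} (hu : ‖u‖ = 1) (hz : z ∈ unitDisc) : u * z ∈ unitDisc := by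
  rw [mem_unitDisc_iff] at *
  rwa [norm_mul, hu, one_mul]

theorem exp_quadratic (η γ : ℝ) (v : ℂ) :
    (1 + (Complex.exp (Complex.I * γ))⁻¹ * v * Complex.exp (Complex.I * (η + γ))) *
      (1 + (Complex.exp (Complex.I * γ))⁻¹ * v * Complex.exp (-Complex.I * (η - γ))) =
      1 + 2 * v * Real.cos η + v ^ 2 := by
  have h1 : Complex.exp (Complex.I * (η + γ)) =
      Complex.exp (Complex.I * γ) * Complex.exp (η * Complex.I) := by
    rw [← Complex.exp_add]; congr 1; ring
  have h2 : Complex.exp (-Complex.I * (η - γ)) =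
      Complex.exp (Complex.I * γ) * Complex.exp (-η * Complex.I) := by
    rw [← Complex.exp_add]; congr 1; ring
  have h3 : Complex.exp (η * Complex.I) * Complex.exp (-η * Complex.I) = 1 := by
    rw [← Complex.exp_add, ← Complex.exp_zero]; congr 1; ring
  have h4 : 2 * Complex.cos η = Complex.exp (η * Complex.I) + Complex.exp (-η * Complex.I) :=
    Complex.two_cos η
  have h5 : (Complex.exp (Complex.I * γ))⁻¹ * Complex.exp (Complex.I * γ) = 1 :=
    inv_mul_cancel₀ (Complex.exp_ne_zero _)
  rw [h1, h2, Complex.ofReal_cos]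
  generalize (Complex.exp (Complex.I * γ))⁻¹ = e' at *
  generalize Complex.exp (Complex.I * γ) = e at *
  generalize Complex.exp (η * Complex.I) = x at *
  generalize Complex.exp (-η * Complex.I) = y at *
  linear_combination (-v) * h4 + (v * (x + y) + v ^ 2 * (x * y) * (e' * e + 1)) * h5 + v ^ 2 * h3

/-- Rotating by `e^{iγ}` makes the quadratic real and absorbs the factor `e^{-2iγ}`. The dilatation
keeps its modulus and gains the constant `e^{-i(n+2)γ}`. -/
theorem IsTMap.isMonomialShear {η γ θ : ℝ} {n : ℕ} {R S : ℂ → ℂ} (hT : IsTMap η γ θ n R S)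
    (hn : 1 ≤ n) :
    IsMonomialShear (Real.cos η) n
      (Complex.exp (Complex.I * θ) * (Complex.exp (Complex.I * γ))⁻¹ ^ (n + 2))
      (fun v => Complex.exp (Complex.I * γ) * R ((Complex.exp (Complex.I * γ))⁻¹ * v))
      (fun v => (Complex.exp (Complex.I * γ))⁻¹ * S ((Complex.exp (Complex.I * γ))⁻¹ * v)) := by
  set e := Complex.exp (Complex.I * γ) with he
  have hen : ‖e⁻¹‖ = 1 := by rw [norm_inv, he, norm_exp_I_mul, inv_one]
  have he0 : e ≠ 0 := Complex.exp_ne_zero _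
  have he2 : Complex.exp (-2 * Complex.I * γ) = e⁻¹ ^ 2 := by
    rw [he, ← Complex.exp_neg, ← Complex.exp_nat_mul]; congr 1; push_cast; ring
  have hl : ∀ v : ℂ, HasDerivAt (fun v => e⁻¹ * v) e⁻¹ v := fun v => by
    simpa using (hasDerivAt_id v).const_mul e⁻¹
  have hRd : ∀ v ∈ unitDisc, HasDerivAt (fun v => e * R (e⁻¹ * v)) (deriv R (e⁻¹ * v)) v := by
    intro v hv
    have hd := (hT.analytic_R.differentiableAt_unitDisc (mul_mem_unitDisc hen hv)).hasDerivAt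
    refine ((hd.comp v (hl v)).const_mul e).congr_deriv ?_
    field_simp
  have hSd : ∀ v ∈ unitDisc,
      HasDerivAt (fun v => e⁻¹ * S (e⁻¹ * v)) (e⁻¹ ^ 2 * deriv S (e⁻¹ * v)) v := by
    intro v hv
    have hd := (hT.analytic_S.differentiableAt_unitDisc (mul_mem_unitDisc hen hv)).hasDerivAt
    refine ((hd.comp v (hl v)).const_mul e⁻¹).congr_deriv ?_
    ring
  obtain ⟨f, hf, hfz, hRS⟩ := hT.sum_eq
  have hfd : ∀ v ∈ unitDisc, deriv f (e⁻¹ * v) = (1 + 2 * v * Real.cos η + v ^ 2)⁻¹ := by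
    intro v hv
    rcases eq_or_ne v 0 with rfl | hv0
    -- At `z = 0` the equation for `z f'(z)` reads `0 = 0`; differentiating it there recovers `f'(0)
    -- = 1`.
    · have h1 : HasDerivAt (fun z => z * deriv f z) (deriv f 0) 0 := by
        have := ((differentiableOn_deriv_unitDisc hf).differentiableAt_unitDisc hv).hasDerivAt
        exact ((hasDerivAt_id (0 : ℂ)).mul this).congr_deriv (by simp)
      have h2 : HasDerivAt (fun z : ℂ => z / ((1 + z * Complex.exp (Complex.I * (η + γ))) *
          (1 + z * Complex.exp (-Complex.I * (η - γ))))) 1 0 := by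
        have h3 : DifferentiableAt ℂ (fun z : ℂ => (1 + z * Complex.exp (Complex.I * (η + γ))) *
          (1 + z * Complex.exp (-Complex.I * (η - γ)))) 0 := by fun_prop
        exact ((hasDerivAt_id (0 : ℂ)).div h3.hasDerivAt (by simp)).congr_deriv (by simp)
      have h4 := h1.unique (h2.congr_of_eventuallyEq (by
        filter_upwards [isOpen_unitDisc.mem_nhds hv] with z hz using hfz z hz))
      simp [h4]
    · have h1 := hfz _ (mul_mem_unitDisc hen hv)
      rw [exp_quadratic, div_eq_mul_inv] at h1
      exact mul_left_cancel₀ (mul_ne_zero (inv_ne_zero he0) hv0) h1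
  refine ⟨fun v hv => (hRd v hv).differentiableAt.differentiableWithinAt,
    fun v hv => (hSd v hv).differentiableAt.differentiableWithinAt, ?_, Real.abs_cos_le_one η,
    by omega, ?_, ?_⟩
  · rw [norm_mul, norm_exp_I_mul, norm_pow, hen, one_pow, one_mul]
  · intro v hv
    rw [(hRd v hv).deriv, (hSd v hv).deriv, ← hfd v hv]
    have hv' := mul_mem_unitDisc hen hv
    have h1 := (hT.analytic_R.differentiableAt_unitDisc hv').hasDerivAt.add
      ((hT.analytic_S.differentiableAt_unitDisc hv').hasDerivAt.const_mul (e⁻¹ ^ 2))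
    have h2 := (hf.differentiableAt_unitDisc hv').hasDerivAt
    refine h1.unique (h2.congr_of_eventuallyEq ?_)
    filter_upwards [isOpen_unitDisc.mem_nhds hv'] with z hz
    rw [← hRS z hz, he2]
    rfl
  · intro v hv
    rw [(hRd v hv).deriv, (hSd v hv).deriv, hT.dilatation _ (mul_mem_unitDisc hen hv)]
    ring

/-- Rotating and rescaling a map whose image has connected horizontal slices. -/
theorem ConvexInDirection.of_rotation {K K₀ : ℂ → ℂ} {β : ℝ}
    (hK : ∀ z ∈ unitDisc, K z = (Complex.exp (Complex.I * β))⁻¹ / 2 *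
      K₀ (Complex.exp (Complex.I * β) * z))
    (h : ∀ s : ℝ, IsPreconnected (K₀ '' unitDisc ∩ {ζ | ζ.im = s})) :
    ConvexInDirection (-β) (K '' unitDisc) := by
  intro w
  set ρ := Complex.exp (Complex.I * β) with hρ
  have hρ0 : ρ ≠ 0 := Complex.exp_ne_zero _
  have hρn : ‖ρ‖ = 1 := norm_exp_I_mul β
  have hρn' : ‖ρ⁻¹‖ = 1 := by rw [norm_inv, hρn, inv_one]
  have hρi : Complex.exp (Complex.I * ((-β : ℝ) : ℂ)) = ρ⁻¹ := by
    rw [hρ, ← Complex.exp_neg]; congr 1; push_cast; ring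
  rw [hρi]
  have himg : K '' unitDisc ∩ range (fun t : ℝ => w + (t : ℂ) * ρ⁻¹) =
      (fun ζ => ρ⁻¹ / 2 * ζ) '' (K₀ '' unitDisc ∩ {ζ | ζ.im = (2 * ρ * w).im}) := by
    ext y
    constructor
    · rintro ⟨⟨z, hz, rfl⟩, t, ht⟩
      refine ⟨K₀ (ρ * z), ⟨⟨ρ * z, mul_mem_unitDisc hρn hz, rfl⟩, ?_⟩, (hK z hz).symm⟩
      have h1 : K₀ (ρ * z) = 2 * ρ * w + ((2 * t : ℝ) : ℂ) := by
        have h2 : w + t * ρ⁻¹ = ρ⁻¹ / 2 * K₀ (ρ * z) := by rw [← hK z hz]; exact ht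
        field_simp at h2
        push_cast
        linear_combination -h2
      change (K₀ (ρ * z)).im = _
      rw [h1, Complex.add_im, Complex.ofReal_im, add_zero]
    · rintro ⟨_, ⟨⟨v, hv, rfl⟩, hs⟩, rfl⟩
      have e : ρ * (ρ⁻¹ * v) = v := mul_inv_cancel_left₀ hρ0 v
      have hv' := mul_mem_unitDisc hρn' hv
      refine ⟨⟨ρ⁻¹ * v, hv', by rw [hK _ hv', e]⟩, (K₀ v - 2 * ρ * w).re / 2, ?_⟩
      have hs' : (K₀ v).im = (2 * ρ * w).im := hs
      have h1 : (((K₀ v - 2 * ρ * w).re : ℝ) : ℂ) = K₀ v - 2 * ρ * w := by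
        apply Complex.ext
        · simp
        · rw [Complex.ofReal_im, Complex.sub_im, hs', sub_self]
      change w + (((K₀ v - 2 * ρ * w).re / 2 : ℝ) : ℂ) * ρ⁻¹ = ρ⁻¹ / 2 * K₀ v
      rw [Complex.ofReal_div, h1]
      push_cast
      field_simp
      ring
  rw [himg]
  exact (h _).image _ (by fun_prop)

theorem mem_classSH_of_add_conj {F h g : ℂ → ℂ} (hh : DifferentiableOn ℂ h unitDisc)
    (hg : DifferentiableOn ℂ g unitDisc) (hF : ∀ z ∈ unitDisc, F z = h z + conj (g z))
    (hinj : InjOn F unitDisc) (h0 : h 0 = 0) (g0 : g 0 = 0) (h1 : deriv h 0 = 1)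
    (hlt : ∀ z ∈ unitDisc, ‖deriv g z‖ < ‖deriv h z‖) : F ∈ classSH := by
  refine ⟨fun z hz => ?_, hinj, h, g, hh, hg, hF, h0, g0, h1, hlt⟩
  have hz' := isOpen_unitDisc.mem_nhds hz
  refine (InnerProductSpace.harmonicAt_congr_nhds (f₂ := h + conj g) ?_).2
    ((hh.analyticAt hz').harmonicAt.add (hg.analyticAt hz').harmonicAt_conj)
  filter_upwards [hz'] with w hw using hF w hw

/-- The lower bound on `a` is `(1-a)n ≤ 2(1+a)` rearranged. -/
theorem convolution_parameter {a : ℝ} {n : ℕ} (hn : 1 ≤ n)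
    (ha : a ∈ Set.Ico (((n : ℝ) - 2) / ((n : ℝ) + 2)) 1) :
    -1 < a ∧ 0 < (1 - a) / (1 + a) ∧ (1 - a) / (1 + a) * n ≤ 2 := by
  have hn' : (1 : ℝ) ≤ n := by exact_mod_cast hn
  have h1 := (div_le_iff₀ (by linarith : (0 : ℝ) < n + 2)).1 ha.1
  have h2 := ha.2
  have h3 : -1 < a := by nlinarith
  have h4 : 0 < 1 + a := by linarith
  refine ⟨h3, div_pos (by linarith) h4, ?_⟩
  rw [div_mul_eq_mul_div, div_le_iff₀ h4]
  linarith

theorem theorem2p3 (a α η γ θ : ℝ) (n : ℕ) (hn : 1 ≤ n)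
    (ha : a ∈ Set.Ico (((n : ℝ) - 2) / ((n : ℝ) + 2)) 1)
    (H G R S : ℂ → ℂ)
    (hF : IsSlantedHalfPlaneMap a α H G)
    (hT : IsTMap η γ θ n R S) :
    (fun z => (1 + (a : ℂ)) * harmonicConv H G R S z) ∈ classSH ∧
      ConvexInDirection (-(α + γ)) (harmonicConv H G R S '' unitDisc) := by
  obtain ⟨ha1, hc, hcn⟩ := convolution_parameter hn ha
  have hM := hT.isMonomialShear hn
  set e := Complex.exp (Complex.I * γ) with he
  set u := Complex.exp (Complex.I * α) with hu
  set ζ := Complex.exp (Complex.I * θ) * e⁻¹ ^ (n + 2)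
  set R₁ : ℂ → ℂ := fun v => e * R (e⁻¹ * v) with hR₁
  set S₁ : ℂ → ℂ := fun v => e⁻¹ * S (e⁻¹ * v) with hS₁
  set c : ℝ := (1 - a) / (1 + a) with hcdef
  have hcc : ((1 - a) / (1 + a) : ℂ) = c := by rw [hcdef]; push_cast; ring
  have he0 : e ≠ 0 := Complex.exp_ne_zero _
  have hu0 : u ≠ 0 := Complex.exp_ne_zero _
  have hun : ‖u‖ = 1 := norm_exp_I_mul α
  set ρ := Complex.exp (Complex.I * ((α + γ : ℝ) : ℂ)) with hρ
  have hρn : ‖ρ‖ = 1 := norm_exp_I_mul (α + γ)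
  have hρue : ρ = u * e := by
    rw [hρ, hu, he, ← Complex.exp_add]; congr 1; push_cast; ring
  have hρ0 : ρ ≠ 0 := Complex.exp_ne_zero _
  set P : ℂ → ℂ := fun v => R₁ v + c * (v * deriv R₁ v) with hP
  set Q : ℂ → ℂ := fun v => S₁ v - c * (v * deriv S₁ v) with hQ
  have hR₁d : ∀ v, deriv R₁ v = deriv R (e⁻¹ * v) := fun v => by
    rw [hR₁, deriv_const_mul_field, deriv_comp_mul_left]
    simp [he0]
  have hS₁d : ∀ v, deriv S₁ v = e⁻¹ ^ 2 * deriv S (e⁻¹ * v) := fun v => by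
    rw [hS₁, deriv_const_mul_field, deriv_comp_mul_left, smul_eq_mul]
    ring
  have harg : ∀ z, e⁻¹ * (ρ * z) = u * z := fun z => by rw [hρue]; field_simp
  have hHR : ∀ z ∈ unitDisc, hadamard H R z = ρ⁻¹ / 2 * P (ρ * z) := by
    intro z hz
    rw [hadamard_eq_of_taylorCoeff hun hT.analytic_R hT.R_zero
      (fun k hk => (hF.taylorCoeff_eq ha1 ha.2 k hk).1) hz, hcc, Complex.exp_neg, ← hu]
    simp only [hP, hR₁d]
    simp only [hR₁, harg]
    rw [hρue]
    field_simp
  have hGS : ∀ z ∈ unitDisc, hadamard G S z = ρ / 2 * Q (ρ * z) := by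
    intro z hz
    rw [hadamard_eq_of_taylorCoeff hun hT.analytic_S hT.S_zero
      (fun k hk => (hF.taylorCoeff_eq ha1 ha.2 k hk).2) hz, hcc, ← hu]
    simp only [hQ, hS₁d]
    simp only [hS₁, harg]
    rw [hρue]
    field_simp
    ring
  have hconj : conj ρ = ρ⁻¹ := (Complex.inv_eq_conj hρn).symm
  have hK : ∀ z ∈ unitDisc, harmonicConv H G R S z =
      ρ⁻¹ / 2 * (fun v => P v + conj (Q v)) (ρ * z) := by
    intro z hz
    rw [harmonicConv, hHR z hz, hGS z hz]
    simp only [map_mul, map_div₀, hconj, map_ofNat]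
    ring
  obtain ⟨hinj, hconn⟩ := hM.injOn_and_isPreconnected hc hcn
  refine ⟨?_, ConvexInDirection.of_rotation hK hconn⟩
  have hPd : ∀ v ∈ unitDisc, HasDerivAt P (deriv P v) v := fun v hv => by
    obtain ⟨Y, Z, -, -, -, -, hp, -⟩ := hM.exists_hasDerivAt c hv
    exact hp.differentiableAt.hasDerivAt
  have hQd : ∀ v ∈ unitDisc, HasDerivAt Q (deriv Q v) v := fun v hv => by
    obtain ⟨Y, Z, -, -, -, -, -, hq⟩ := hM.exists_hasDerivAt c hv
    exact hq.differentiableAt.hasDerivAt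
  have hl : ∀ z : ℂ, HasDerivAt (fun z => ρ * z) ρ z := fun z => by
    simpa using (hasDerivAt_id z).const_mul ρ
  have hhd : ∀ z ∈ unitDisc, HasDerivAt (fun z => (1 + (a : ℂ)) * hadamard H R z)
      ((1 + a) / 2 * deriv P (ρ * z)) z := by
    intro z hz
    have h1 := (((hPd _ (mul_mem_unitDisc hρn hz)).comp z (hl z)).const_mul (ρ⁻¹ / 2)).const_mul
      (1 + (a : ℂ))
    refine (h1.congr_of_eventuallyEq ?_).congr_deriv (by field_simp)
    filter_upwards [isOpen_unitDisc.mem_nhds hz] with w hw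
    rw [hHR w hw]
    rfl
  have hgd : ∀ z ∈ unitDisc, HasDerivAt (fun z => (1 + (a : ℂ)) * hadamard G S z)
      ((1 + a) / 2 * (ρ ^ 2 * deriv Q (ρ * z))) z := by
    intro z hz
    have h1 := (((hQd _ (mul_mem_unitDisc hρn hz)).comp z (hl z)).const_mul (ρ / 2)).const_mul
      (1 + (a : ℂ))
    refine (h1.congr_of_eventuallyEq ?_).congr_deriv (by ring)
    filter_upwards [isOpen_unitDisc.mem_nhds hz] with w hw
    rw [hGS w hw]
    rfl
  have ha0 : (1 + a : ℂ) ≠ 0 := by norm_cast; linarith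
  refine mem_classSH_of_add_conj (h := fun z => (1 + (a : ℂ)) * hadamard H R z)
    (g := fun z => (1 + (a : ℂ)) * hadamard G S z)
    (fun z hz => (hhd z hz).differentiableAt.differentiableWithinAt)
    (fun z hz => (hgd z hz).differentiableAt.differentiableWithinAt) (fun z _ => ?_)
    ?_ ?_ ?_ ?_ ?_
  · simp only [harmonicConv, map_mul, map_add, map_one, Complex.conj_ofReal]
    ring
  · intro z₁ hz₁ z₂ hz₂ h
    have h1 := mul_left_cancel₀ ha0 h
    rw [hK z₁ hz₁, hK z₂ hz₂] at h1
    have h2 := mul_left_cancel₀ (div_ne_zero (inv_ne_zero hρ0) two_ne_zero) h1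
    exact mul_left_cancel₀ hρ0
      (hinj (mul_mem_unitDisc hρn hz₁) (mul_mem_unitDisc hρn hz₂) h2)
  · simp [hHR 0 zero_mem_unitDisc, hP, hR₁, hT.R_zero]
  · simp [hGS 0 zero_mem_unitDisc, hQ, hS₁, hT.S_zero]
  · rw [(hhd 0 zero_mem_unitDisc).deriv, mul_zero]
    obtain ⟨Y, Z, -, -, hY, hZ, hp, -⟩ := hM.exists_hasDerivAt c zero_mem_unitDisc
    rw [hp.deriv, hM.deriv_R zero_mem_unitDisc, hY, hZ, ← hcc]
    -- Since `n ≠ 0`, the dilatation vanishes at `0`, so `Y = Z = 1` and `P'(0) = 1 + c = 2/(1+a)`.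
    have hn0 : n ≠ 0 := by omega
    simp [hn0]
    field_simp
    ring
  · intro z hz
    rw [(hhd z hz).deriv, (hgd z hz).deriv, norm_mul, norm_mul, norm_mul, norm_pow, hρn, one_pow,
      one_mul]
    have : 0 < ‖((1 + a) / 2 : ℂ)‖ := norm_pos_iff.2 (div_ne_zero ha0 two_ne_zero)
    exact mul_lt_mul_of_pos_left
      (hM.norm_deriv_lt hc hcn (mul_mem_unitDisc hρn hz)) this
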